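/- **Conventions.** Let $n\ge 1$, $g\ge 0$ and $\omega\in S_n$. Permutations are multiplied from left to right, $c(\omega)$ is the number of cycles of $\omega$ (fixed points included), and $\gamma^{\omega}:=\omega\gamma\omega^{-1}$. A transposition is written $(a\,b)$ with $a<b$, or with $a\prec b$ when another linear order $\prec$ on $[n]$ is considered. * $A_g(\omega)$ is the set of genus-$g$ transitive star factorisations of $\omega$: tuples $((a_1\,n),\dots,(a_m\,n))$ with $a_i<n$, $(a_1\,n)\cdots(a_m\,n)=\omega$ and $m=n+c(\omega)-2+2g$, whose entries generate a group acting transitively on $[n]$. * $\vec H_g(\omega)$ is the set of genus-$g$ monotone double Hurwitz factorisations of $\omega$: tuples $(\sigma,(a_1\,b_1),\dots,(a_m\,b_m))$ with $\sigma(a_1\,b_1)\cdots(a_m\,b_m)=\omega$, $\sigma$ an $n$-cycle (cycle type $(n)$), $a_i<b_i$, $b_1\le\dots\le b_m$ and $m=c(\omega)-1+2g$. * The rightward Hurwitz move replaces adjacent factors $\tau\,\sigma$ by $\sigma^{\tau}\,\tau$; the leftward one replaces them by $\sigma\,\tau^{\sigma}$. **Reordering maps.** Let $\prec$ be a linear order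 $i_1\prec\dots\prec i_n$ on $[n]$, let $1\le j\le n-1$, and let $h=((a_1\,b_1),\dots,(a_k\,b_k))$ satisfy $a_i\prec b_i$ and $b_1\preceq\dots\preceq b_k$. Let string 1, respectively string 2, be the block of factors of $h$ with larger element $i_j$, respectively $i_{j+1}$. Define $\Lambda_j(h)$ in two stages, leaving all other factors unchanged. (1) Starting with the rightmost, move each factor of string 1 to the right by rightward Hurwitz moves through all the factors obtained from string 2; this gives string 1' (all factors containing $i_{j+1}$) followed by string 1. (2) Starting with the rightmost, move each factor $(i_j\,i_{j+1})$ of string 1' to the right by rightward Hurwitz moves through the factors $(a\,i_{j+1})$, $a\neq i_j$, of string 1' that are still to its right; each of these becomes $(a\,i_j)$, and it and the moved factor no longer count as part of string 1'. The result is monotone relative to the order $\prec^{(j)}$ obtained from $\prec$ by exchanging $i_j$ and $i_{j+1}$. For every order $\prec$ fix any expression, not necessarily reduced, of the permutation $k\mapsto i_k$ as a product $s_{j_1}s_{j_2}\cdots s_{j_r}$ of simple transpositions $s_j=(j\;j{+}1)$; such expressions exist. Let $\Lambda^{\prec}$ be the composite of $\Lambda_{j_1},\Lambda_{j_2},\dots,\Lambda_{j_r}$,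 applied in this order, each relative to the order reached so far; the last order reached is the natural one. **The map $\Gamma$.** Let $f\in A_g(\omega)$. Underline the first appearance of each $(i\,n)$ in $f$, reading from left to right; let these be $(i_1\,n),\dots,(i_{n-1}\,n)$ in order of appearance, put $i_n=n$, and let $\prec$ be the order $i_1\prec\dots\prec i_n$. For $p=2,\dots,n-1$ in turn, move the underlined $(i_p\,n)$ to the left by leftward Hurwitz moves until it stands immediately to the right of the underlined $(i_{p-1}\,n)$. The result has the form $(i_1\,n)\cdots(i_{n-1}\,n)\,h$, where $h$ is monotone relative to $\prec$. Put $\sigma=(i_1\,n)\cdots(i_{n-1}\,n)=(i_1\,i_2\cdots i_n)$ and $\Gamma(f)=(\sigma,\Lambda^{\prec}(h))$. **The map $\Theta$.** For $\delta\in S_n$ and $\gamma=\delta\omega\delta^{-1}$, and $f=(\sigma,\tau_1,\dots,\tau_m)\in\vec H_g(\omega)$, put $\Theta(f)=(\sigma^{\delta},\Lambda^{\prec}(\tau_1^{\delta},\dots,\tau_m^{\delta}))$, where $\prec$ is the order $\delta^{-1}(1)\prec\dots\prec\delta^{-1}(n)$. **Theorem 4.1.** Let $n\ge1$, $\omega\in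 S_n$ and $g\ge 0$. For every choice of the expressions above: 1. $\Gamma$ is a bijection $A_g(\omega)\to\vec H_g(\omega)$. 2. For every $\delta\in S_n$ and $\gamma=\delta\omega\delta^{-1}$, $\Theta$ is a bijection $\vec H_g(\omega)\to\vec H_g(\gamma)$, and the composite $$A_g(\omega)\xrightarrow{\ \Gamma\ }\vec H_g(\omega)\xrightarrow{\ \Theta\ }\vec H_g(\gamma)\xrightarrow{\ \Gamma^{-1}\ }A_g(\gamma)$$ is a bijection. Consequently transitive star factorisations are central in all genera: $|A_g(\omega)|=|A_g(\gamma)|$ whenever $\omega$ and $\gamma$ are conjugate in $S_n$. -/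

import Mathlib

namespace StarFactorisation

open Equiv

variable {n : ℕ}

/-- The product `τ₁ τ₂ ⋯ τₘ` of a list of permutations, multiplied from left to right: `τ₁` acts
first.  (Mathlib's `σ * τ` lets `τ` act first.) -/
def prodLR : List (Perm (Fin n)) → Perm (Fin n)
  | [] => 1
  | τ :: L => prodLR L * τ

/-- The conjugate `γ ^ ω = ω γ ω⁻¹`, the product being taken from left to right. -/
def conj (γ ω : Perm (Fin n)) : Perm (Fin n) := prodLR [ω, γ, ω⁻¹]

/-- The number `c(ω)` of cycles of `ω`, fixed points included. -/
def numCycles (ω : Perm (Fin n)) : ℕ := ω.partition.parts.card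

/-- The set `A_g(ω)` of genus `g` transitive star factorisations of `ω`.  The symbols `1, …, n` are
the elements of `Fin n`; the distinguished symbol `n` is the largest one, `⊤`. -/
def starFactorisations [NeZero n] (g : ℕ) (ω : Perm (Fin n)) : Set (List (Perm (Fin n))) :=
  {f | (∀ τ ∈ f, ∃ a : Fin n, a < ⊤ ∧ τ = swap a ⊤) ∧
    prodLR f = ω ∧
    f.length + 2 = n + numCycles ω + 2 * g ∧
    MulAction.IsPretransitive (Subgroup.closure {τ | τ ∈ f}) (Fin n)}

/-- A list of transpositions `(a₁ b₁), …, (aₘ bₘ)` with `aᵢ < bᵢ` and `b₁ ≤ b₂ ≤ ⋯ ≤ bₘ`. -/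
def IsMonotone (L : List (Perm (Fin n))) : Prop :=
  ∃ p : List (Fin n × Fin n), L = p.map (fun q => swap q.1 q.2) ∧
    (∀ q ∈ p, q.1 < q.2) ∧ p.Pairwise (fun q r => q.2 ≤ r.2)

/-- The set of genus `g` monotone double Hurwitz factorisations `σ (a₁ b₁) ⋯ (aₘ bₘ) = ω`, where
`σ` has cycle type `(n)`. -/
def monotoneDoubleHurwitz (g : ℕ) (ω : Perm (Fin n)) :
    Set (Perm (Fin n) × List (Perm (Fin n))) :=
  {f | prodLR (f.1 :: f.2) = ω ∧
    f.1.partition.parts = {n} ∧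
    f.2.length + 1 = numCycles ω + 2 * g ∧
    IsMonotone f.2}

/-- The rightward Hurwitz move: `τ σ` becomes `σ^τ τ`. -/
def rhm (τ σ : Perm (Fin n)) : Perm (Fin n) × Perm (Fin n) := (conj σ τ, τ)

/-- The leftward Hurwitz move: `τ σ` becomes `σ τ^σ`. -/
def lhm (τ σ : Perm (Fin n)) : Perm (Fin n) × Perm (Fin n) := (σ, conj τ σ)

/-- Move a factor `τ` to the right through the factors `L`, by rightward Hurwitz moves.  The list
of factors `τ :: L` becomes `pushRight τ L`, whose last entry is `τ`. -/
def pushRight (τ : Perm (Fin n)) : List (Perm (Fin n)) → List (Perm (Fin n))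
  | [] => [τ]
  | σ :: L => (rhm τ σ).1 :: pushRight (rhm τ σ).2 L

/-- Move a factor `σ` to the left through the factors `L`, by leftward Hurwitz moves.  The list of
factors `L ++ [σ]` becomes `u :: L'`, where `pushLeft L σ = (u, L')` (and in fact `u = σ`). -/
def pushLeft : List (Perm (Fin n)) → Perm (Fin n) → Perm (Fin n) × List (Perm (Fin n))
  | [], σ => (σ, [])
  | τ :: L, σ =>
    ((lhm τ (pushLeft L σ).1).1, (lhm τ (pushLeft L σ).1).2 :: (pushLeft L σ).2)

/-! ### Reordering bijections

A linear order `i₁ ≺ i₂ ≺ ⋯ ≺ iₙ` on the symbols is encoded by the permutation `e` with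
`e k = i_k`, so that `a ≺ b` means `e.symm a < e.symm b`. -/

/-- For a transposition `τ`: it has the form `(a x)` with `a ≺ x`. -/
def HasTop (e : Perm (Fin n)) (x : Fin n) (τ : Perm (Fin n)) : Prop :=
  e.symm (τ x) < e.symm x

instance (e : Perm (Fin n)) (x : Fin n) (τ : Perm (Fin n)) : Decidable (HasTop e x τ) :=
  inferInstanceAs (Decidable (_ < _))

/-- The positions `j` and `j + 1` exchanged by the `j`-th simple transposition. -/
def loPos (j : Fin (n - 1)) : Fin n := ⟨j, by omega⟩

/-- See `loPos`. -/
def hiPos (j : Fin (n - 1)) : Fin n := ⟨j + 1, by omega⟩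

/-- The simple transposition `(j j+1)`. -/
def simpleTransposition (j : Fin (n - 1)) : Perm (Fin n) := swap (loPos j) (hiPos j)

/-- Stage 1 of the elementary reordering: beginning with the rightmost one, every transposition
of string 1 is moved to the right through (what has become of) string 2. The result is string 1'
only; string 2', which follows it, is string 1 unchanged.  (When two commuting transpositions
are exchanged, this is also a rightward Hurwitz move.) -/
def stageOne (s₁ s₂ : List (Perm (Fin n))) : List (Perm (Fin n)) :=
  s₁.foldr (fun τ s => (pushRight τ s).dropLast) s₂

/-- Stage 2 of the elementary reordering, applied to string 1', for `κ = (i_j i_{j+1})`: beginning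
with the rightmost one, every occurrence of `κ` is moved by rightward Hurwitz moves through the
factors that are still to the right of it in string 1'; this turns each `(a i_{j+1})` it meets into
`(a i_j)`.  The first component is what is left of string 1', the second one is the list of the
factors affected, which now follow it. -/
def stageTwo (κ : Perm (Fin n)) (s : List (Perm (Fin n))) :
    List (Perm (Fin n)) × List (Perm (Fin n)) :=
  s.foldr (fun τ r => if τ = κ then ([], pushRight κ r.1 ++ r.2) else (τ :: r.1, r.2)) ([], [])

/-- The elementary reordering `Λ_j`.  It takes factorisations that are monotone relative to the
order `≺` encoded by `e` to those monotone relative to the order in which the neighbours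
`i_j` and `i_{j+1}` have been exchanged. -/
def elementaryReorder (e : Perm (Fin n)) (j : Fin (n - 1)) (f : List (Perm (Fin n))) :
    List (Perm (Fin n)) :=
  let x := e (loPos j)
  let y := e (hiPos j)
  let outside : Perm (Fin n) → Bool := fun τ => decide (¬ HasTop e x τ ∧ ¬ HasTop e y τ)
  let before := f.takeWhile outside
  let rest := f.dropWhile outside
  let string₁ := rest.takeWhile (fun τ => decide (HasTop e x τ))
  let rest' := rest.dropWhile (fun τ => decide (HasTop e x τ))
  let string₂ := rest'.takeWhile (fun τ => decide (HasTop e y τ))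
  let after := rest'.dropWhile (fun τ => decide (HasTop e y τ))
  let r := stageTwo (swap x y) (stageOne string₁ string₂)
  before ++ r.1 ++ r.2 ++ string₁ ++ after

/-- Compose the elementary reorderings `Λ_j` along a word; after each step the order is the one
with the two neighbours exchanged. -/
def reorderAlong : Perm (Fin n) → List (Fin (n - 1)) → List (Perm (Fin n)) → List (Perm (Fin n))
  | _, [], f => f
  | e, j :: w, f => reorderAlong (e * simpleTransposition j) w (elementaryReorder e j f)

/-- A choice, for every order `≺` (encoded by `e`), of a way to write the permutation defined by
`≺` as a product of simple transpositions.  The product is not required to be reduced. -/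
abbrev SimpleWords (n : ℕ) : Type :=
  (e : Perm (Fin n)) → {w : List (Fin (n - 1)) // prodLR (w.map simpleTransposition) = e}

theorem prodLR_eq (L : List (Perm (Fin n))) : prodLR L = L.reverse.prod := by
  induction L with
  | nil => rfl
  | cons τ L ih => simp [prodLR, ih]

instance nonempty_simpleWords (n : ℕ) : Nonempty (SimpleWords n) := by
  have key : ∀ e : Perm (Fin n),
      ∃ w : List (Fin (n - 1)), prodLR (w.map simpleTransposition) = e := by
    intro e
    cases n with
    | zero => exact ⟨[], Subsingleton.elim _ _⟩
    | succ m =>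
      have he : e ∈ Submonoid.closure
          (Set.range fun i : Fin m => swap i.castSucc i.succ) := by
        rw [Perm.mclosure_swap_castSucc_succ]; trivial
      obtain ⟨l, hl, rfl⟩ := Submonoid.exists_list_of_mem_closure he
      have : ∀ l : List (Perm (Fin (m + 1))),
          (∀ y ∈ l, y ∈ Set.range fun i : Fin m => swap i.castSucc i.succ) →
          ∃ w : List (Fin (m + 1 - 1)), w.map simpleTransposition = l := by
        intro l
        induction l with
        | nil => exact fun _ => ⟨[], rfl⟩
        | cons a l ih =>
          intro h
          obtain ⟨w, rfl⟩ := ih (fun y hy => h y (List.mem_cons_of_mem _ hy))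
          obtain ⟨i, rfl⟩ := h a List.mem_cons_self
          exact ⟨i :: w, rfl⟩
      obtain ⟨w, hw⟩ := this l.reverse (fun y hy => hl y (List.mem_reverse.1 hy))
      exact ⟨w, by rw [hw, prodLR_eq, List.reverse_reverse]⟩
  choose w hw using key
  exact ⟨fun e => ⟨w e, hw e⟩⟩

/-- The reordering bijection `Λ^≺`, from factorisations that are monotone relative to the order
`≺` encoded by `e` to monotone factorisations, for the chosen words `W`. -/
def reorder (W : SimpleWords n) (e : Perm (Fin n)) (f : List (Perm (Fin n))) :
    List (Perm (Fin n)) :=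
  reorderAlong e (W e).1 f

/-! ### The map `Γ` -/

/-- The leftward shuffle of a star factorisation.  Reading from left to right, the first
appearance of each `(i n)` (an underlined factor) is moved by leftward Hurwitz moves through the
non-underlined factors to its left, up to the preceding underlined factor.  The state `(u, r)`
stands for the product `u ++ r` of the underlined factors `u` and the other factors `r` obtained
so far. -/
def shuffle (f : List (Perm (Fin n))) : List (Perm (Fin n)) × List (Perm (Fin n)) :=
  f.foldl (fun s τ =>
    if τ ∈ s.1 then (s.1, s.2 ++ [τ])
    else (s.1 ++ [(pushLeft s.2 τ).1], (pushLeft s.2 τ).2)) ([], [])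

/-- The order `i₁ ≺ ⋯ ≺ iₙ₋₁ ≺ iₙ = n` defined by the list of underlined factors
`(i₁ n), …, (iₙ₋₁ n)`.  (The value is irrelevant if this is not a list of all the symbols.) -/
def underlinedOrder [NeZero n] (u : List (Perm (Fin n))) : Perm (Fin n) :=
  let l : List (Fin n) := u.map (fun τ => τ ⊤) ++ [⊤]
  if h : l.Nodup ∧ l.length = n ∧ ∀ x, x ∈ l then
    (finCongr h.2.1.symm).trans (h.1.getEquivOfForallMemList l h.2.2)
  else 1

/-- The map `Γ`: the shuffle turns a star factorisation into `(i₁ n) ⋯ (iₙ₋₁ n) h = σ h`, with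
`σ = (i₁ ⋯ iₙ₋₁ n)` and with `h` monotone relative to `≺`; then `h` is replaced by `Λ^≺ (h)`. -/
def Gamma [NeZero n] (W : SimpleWords n) (f : List (Perm (Fin n))) :
    Perm (Fin n) × List (Perm (Fin n)) :=
  (prodLR (shuffle f).1, reorder W (underlinedOrder (shuffle f).1) (shuffle f).2)

/-! ### The map `Θ` -/

/-- The map `Θ` from the monotone double Hurwitz factorisations of `ω` to those of `ω^δ`:
conjugate every factor by `δ`, then apply `Λ^≺` to the transpositions, where `≺` is the order
`δ⁻¹(1) ≺ ⋯ ≺ δ⁻¹(n)`. -/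
def Theta (W : SimpleWords n) (δ : Perm (Fin n)) (f : Perm (Fin n) × List (Perm (Fin n))) :
    Perm (Fin n) × List (Perm (Fin n)) :=
  (conj f.1 δ, reorder W δ⁻¹ (f.2.map (fun τ => conj τ δ)))

end StarFactorisation

/-!
Hurwitz moves by transpositions preserve the product and the number of factors, and so does every
step of the construction apart from the conjugation in `Θ`, which conjugates the product.  Hence
only bijectivity on lists of the right shape is at stake.

*Reordering.*  For `Λ_j`, write a list that is monotone relative to `≺` as `A ++ X ++ Y ++ C`, where
`X` and `Y` are the strings of `i_j` and `i_{j+1}`.  Stage 1 conjugates `Y` by the factors of `X`,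
which permutes the lists of transpositions with larger element `i_{j+1}`.  Stage 2 cuts such a list
at the occurrences of `κ = (i_j i_{j+1})`: the part before the first one becomes the string of
`i_{j+1}` in the new order, and the rest is conjugated piecewise into a list that is empty or ends
in `κ`.  This is followed by `X`, in which `κ` does not occur, so the last `κ` shows where `X`
begins, and both stages can be undone (`bijOn_elementaryReorder`).  As the chosen word leads from
`≺` to the natural order, `Λ^≺` is a bijection whatever the word (`reorder_spec`).

*Shuffle.*  Transitivity of a star factorisation means that every `(a n)` occurs
(`isPretransitive_iff`).  The result of the shuffle determines its last step: if the last factor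
was underlined, all the other factors fix `n`; otherwise the last of them moves `n`.  Hence
the shuffle is injective.  Underlining `(i_p n)` turns the factors `(a n)` collected so far into
`(a i_p)` and keeps the others, so the results are exactly the pairs of an order with largest
element `n` and a list that is monotone relative to it (`bijOn_shuffle`).

*The long cycle.*  The underlined factors multiply to `(i₁ ⋯ iₙ)`, and every long cycle is written
in exactly one way like this with `iₙ = n` (`bijOn_order_cycle`).

Thus `Γ` is a bijection.  `Θ` is conjugation, which carries the natural order to `≺`, followed by
`Λ^≺`.
-/

namespace StarFactorisation

open Equiv

variable {n : ℕ}

/-! ### Hurwitz moves -/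

theorem conj_eq (γ ω : Perm (Fin n)) : conj γ ω = ω⁻¹ * γ * ω := by
  simp [conj, prodLR]

theorem conj_swap (a b : Fin n) (ω : Perm (Fin n)) :
    conj (swap a b) ω = swap (ω⁻¹ a) (ω⁻¹ b) := by
  have := swap_apply_apply ω⁻¹ a b
  rw [this, conj_eq]; simp

theorem conj_injective (ω : Perm (Fin n)) : Function.Injective fun γ => conj γ ω := by
  intro a b h
  simpa [conj_eq] using h

theorem conj_conj_swap (γ : Perm (Fin n)) (a b : Fin n) :
    conj (conj γ (swap a b)) (swap a b) = γ := by
  simp [conj_eq, mul_assoc]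

theorem conj_eq_self_iff (τ κ : Perm (Fin n)) : conj τ κ = κ ↔ τ = κ := by
  rw [conj_eq]
  constructor
  · intro h
    have : τ * κ = κ * κ := by rw [mul_assoc, inv_mul_eq_iff_eq_mul] at h; exact h
    exact mul_right_cancel this
  · rintro rfl; simp

theorem prodLR_append (L M : List (Perm (Fin n))) : prodLR (L ++ M) = prodLR M * prodLR L := by
  simp [prodLR_eq]

theorem prodLR_map_conj (ω : Perm (Fin n)) (L : List (Perm (Fin n))) :
    prodLR (L.map fun τ => conj τ ω) = conj (prodLR L) ω := by
  induction L with
  | nil => simp [prodLR, conj_eq]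
  | cons τ L ih =>
    rw [List.map_cons, prodLR, prodLR, ih]
    simp [conj_eq, mul_assoc]

theorem pushRight_eq (τ : Perm (Fin n)) (L : List (Perm (Fin n))) :
    pushRight τ L = L.map (fun σ => conj σ τ) ++ [τ] := by
  induction L with
  | nil => rfl
  | cons σ L ih => simp [pushRight, rhm, ih]

theorem pushLeft_eq (L : List (Perm (Fin n))) (σ : Perm (Fin n)) :
    pushLeft L σ = (σ, L.map fun τ => conj τ σ) := by
  induction L with
  | nil => rfl
  | cons τ L ih => simp [pushLeft, lhm, ih]

theorem stageOne_nil (s : List (Perm (Fin n))) : stageOne [] s = s := rfl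

theorem stageOne_cons (τ : Perm (Fin n)) (s₁ s₂ : List (Perm (Fin n))) :
    stageOne (τ :: s₁) s₂ = (stageOne s₁ s₂).map fun σ => conj σ τ := by
  simp [stageOne, pushRight_eq]

theorem stageOne_injective (s₁ : List (Perm (Fin n))) : Function.Injective (stageOne s₁) := by
  induction s₁ with
  | nil => exact fun _ _ h => h
  | cons τ s₁ ih =>
    intro s t h
    rw [stageOne_cons, stageOne_cons] at h
    exact ih (List.map_injective_iff.2 (conj_injective τ) h)

theorem length_stageOne (s₁ s₂ : List (Perm (Fin n))) : (stageOne s₁ s₂).length = s₂.length := by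
  induction s₁ with
  | nil => rfl
  | cons τ s₁ ih => simp [stageOne_cons, ih]

theorem prodLR_stageOne (s₁ s₂ : List (Perm (Fin n))) :
    prodLR (stageOne s₁ s₂ ++ s₁) = prodLR (s₁ ++ s₂) := by
  induction s₁ with
  | nil => simp [stageOne_nil]
  | cons τ s₁ ih =>
    rw [prodLR_append] at ih
    rw [stageOne_cons, prodLR_append, prodLR_map_conj, List.cons_append, prodLR, prodLR, ← ih,
      conj_eq]
    group

section stageTwo

variable (κ : Perm (Fin n))

theorem stageTwo_cons_self (s : List (Perm (Fin n))) :
    stageTwo κ (κ :: s) =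
      ([], (stageTwo κ s).1.map (fun σ => conj σ κ) ++ κ :: (stageTwo κ s).2) := by
  simp [stageTwo, pushRight_eq]

theorem stageTwo_cons_of_ne {τ : Perm (Fin n)} (h : τ ≠ κ) (s : List (Perm (Fin n))) :
    stageTwo κ (τ :: s) = (τ :: (stageTwo κ s).1, (stageTwo κ s).2) := by
  simp [stageTwo, h]

theorem length_stageTwo (s : List (Perm (Fin n))) :
    (stageTwo κ s).1.length + (stageTwo κ s).2.length = s.length := by
  induction s with
  | nil => rfl
  | cons τ s ih =>
    by_cases h : τ = κ
    · subst h; simp [stageTwo_cons_self]; omega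
    · simp [stageTwo_cons_of_ne κ h]; omega

theorem prodLR_stageTwo (s : List (Perm (Fin n))) :
    prodLR ((stageTwo κ s).1 ++ (stageTwo κ s).2) = prodLR s := by
  induction s with
  | nil => rfl
  | cons τ s ih =>
    by_cases h : τ = κ
    · subst h
      rw [stageTwo_cons_self, prodLR, ← ih]
      simp only [List.nil_append, prodLR_append, prodLR, prodLR_map_conj]
      rw [conj_eq]
      group
    · rw [stageTwo_cons_of_ne κ h, List.cons_append, prodLR, prodLR, ih]

theorem not_mem_stageTwo_fst (s : List (Perm (Fin n))) : κ ∉ (stageTwo κ s).1 := by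
  induction s with
  | nil => simp [stageTwo]
  | cons τ s ih =>
    by_cases h : τ = κ
    · subst h; simp [stageTwo_cons_self]
    · simp [stageTwo_cons_of_ne κ h, ih, Ne.symm h]

theorem not_mem_map_conj {L : List (Perm (Fin n))} (h : κ ∉ L) :
    κ ∉ L.map fun σ => conj σ κ := by
  rw [List.mem_map]
  rintro ⟨τ, hτ, h'⟩
  exact h ((conj_eq_self_iff _ _).1 h' ▸ hτ)

/-- A list is determined by the part before the first occurrence of `κ` and the part after it. -/
theorem append_cons_inj {α : Type*} {k : α} {L L' M M' : List α} (hL : k ∉ L) (hL' : k ∉ L')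
    (h : L ++ k :: M = L' ++ k :: M') : L = L' ∧ M = M' := by
  induction L generalizing L' with
  | nil =>
    cases L' with
    | nil => simpa using h
    | cons a L' => simp at h hL'; exact absurd h.1 hL'.1
  | cons a L ih =>
    cases L' with
    | nil => simp at h hL; exact absurd h.1.symm hL.1
    | cons b L' =>
      simp only [List.cons_append, List.cons.injEq] at h
      obtain ⟨h1, h2⟩ := ih (fun hm => hL (.tail _ hm)) (fun hm => hL' (.tail _ hm)) h.2
      exact ⟨by rw [h.1, h1], h2⟩

theorem stageTwo_injective : Function.Injective (stageTwo κ) := by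
  intro s
  induction s with
  | nil =>
    intro t h
    have h1 := length_stageTwo κ t
    rw [← h] at h1
    exact (List.length_eq_zero_iff.1 h1.symm).symm
  | cons τ s ih =>
    intro t h
    cases t with
    | nil =>
      have h1 := length_stageTwo κ (τ :: s)
      rw [h] at h1
      simp [stageTwo] at h1
    | cons ρ t =>
      by_cases h1 : τ = κ <;> by_cases h2 : ρ = κ
      · subst h1; subst h2
        rw [stageTwo_cons_self, stageTwo_cons_self] at h
        obtain ⟨h3, h4⟩ := append_cons_inj (not_mem_map_conj _ (not_mem_stageTwo_fst _ _))
          (not_mem_map_conj _ (not_mem_stageTwo_fst _ _)) (Prod.ext_iff.1 h).2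
        rw [ih (Prod.ext (List.map_injective_iff.2 (conj_injective _) h3) h4)]
      · subst h1
        rw [stageTwo_cons_self, stageTwo_cons_of_ne _ h2] at h
        simp at h
      · subst h2
        rw [stageTwo_cons_self, stageTwo_cons_of_ne _ h1] at h
        simp at h
      · rw [stageTwo_cons_of_ne _ h1, stageTwo_cons_of_ne _ h2] at h
        simp only [Prod.mk.injEq, List.cons.injEq] at h
        rw [h.1.1, ih (Prod.ext h.1.2 h.2)]

theorem stageTwo_append {L : List (Perm (Fin n))} (h : κ ∉ L) (s : List (Perm (Fin n))) :
    stageTwo κ (L ++ s) = (L ++ (stageTwo κ s).1, (stageTwo κ s).2) := by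
  induction L with
  | nil => rfl
  | cons τ L ih =>
    simp only [List.mem_cons, not_or] at h
    rw [List.cons_append, stageTwo_cons_of_ne _ (Ne.symm h.1), ih h.2]
    rfl

theorem mem_stageTwo_fst {s : List (Perm (Fin n))} {τ : Perm (Fin n)}
    (h : τ ∈ (stageTwo κ s).1) : τ ∈ s := by
  induction s with
  | nil => simp [stageTwo] at h
  | cons ρ s ih =>
    by_cases h' : ρ = κ
    · subst h'; simp [stageTwo_cons_self] at h
    · simp only [stageTwo_cons_of_ne _ h', List.mem_cons] at h ⊢
      exact h.imp_right ih

theorem mem_stageTwo_snd {s : List (Perm (Fin n))} {τ : Perm (Fin n)}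
    (h : τ ∈ (stageTwo κ s).2) : τ = κ ∨ ∃ ρ ∈ s, ρ ≠ κ ∧ τ = conj ρ κ := by
  induction s with
  | nil => simp [stageTwo] at h
  | cons ρ s ih =>
    have lift : (τ = κ ∨ ∃ σ ∈ s, σ ≠ κ ∧ τ = conj σ κ) →
        τ = κ ∨ ∃ σ ∈ ρ :: s, σ ≠ κ ∧ τ = conj σ κ :=
      Or.imp_right fun ⟨σ, h1, h2⟩ => ⟨σ, .tail _ h1, h2⟩
    by_cases h' : ρ = κ
    · subst h'
      simp only [stageTwo_cons_self, List.mem_append, List.mem_map, List.mem_cons] at h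
      rcases h with ⟨σ, h1, rfl⟩ | h | h
      · exact .inr ⟨σ, .tail _ (mem_stageTwo_fst _ h1),
          fun h2 => not_mem_stageTwo_fst _ _ (h2 ▸ h1), rfl⟩
      · exact .inl h
      · exact lift (ih h)
    · rw [stageTwo_cons_of_ne _ h'] at h
      exact lift (ih h)

/-- The second component of `stageTwo κ s` is empty or ends in `κ`. -/
theorem stageTwo_snd_eq (s : List (Perm (Fin n))) :
    (stageTwo κ s).2 = [] ∨ ∃ L, (stageTwo κ s).2 = L ++ [κ] := by
  induction s with
  | nil => exact .inl rfl
  | cons τ s ih =>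
    by_cases h : τ = κ
    · subst h
      right
      rw [stageTwo_cons_self]
      rcases ih with h | ⟨L, h⟩
      · exact ⟨_, by rw [h]⟩
      · refine ⟨(stageTwo τ s).1.map (fun σ => conj σ τ) ++ τ :: L, ?_⟩
        rw [h]; simp
    · rwa [stageTwo_cons_of_ne _ h]

/-- Every list is uniquely the concatenation of a list that is empty or ends in `κ` and a list
without `κ`; this is the existence. -/
theorem exists_split_last (X : List (Perm (Fin n))) :
    ∃ R S, X = R ++ S ∧ κ ∉ S ∧ (R = [] ∨ ∃ L, R = L ++ [κ]) := by
  induction X using List.reverseRecOn with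
  | nil => exact ⟨[], [], rfl, by simp, .inl rfl⟩
  | append_singleton X τ ih =>
    by_cases h : τ = κ
    · exact ⟨X ++ [τ], [], by simp, by simp, .inr ⟨X, by rw [h]⟩⟩
    · obtain ⟨R, S, rfl, hS, hR⟩ := ih
      exact ⟨R, S ++ [τ], by simp, by simp [hS, Ne.symm h], hR⟩

theorem split_last_inj {R S R' S' : List (Perm (Fin n))} (hS : κ ∉ S) (hS' : κ ∉ S')
    (hR : R = [] ∨ ∃ L, R = L ++ [κ]) (hR' : R' = [] ∨ ∃ L, R' = L ++ [κ])
    (h : R ++ S = R' ++ S') : R = R' ∧ S = S' := by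
  rcases hR with rfl | ⟨L, rfl⟩ <;> rcases hR' with rfl | ⟨L', rfl⟩
  · exact ⟨rfl, h⟩
  · exact absurd (by simp at h; simp [h]) hS
  · exact absurd (by simp at h; simp [← h]) hS'
  · have h2 := congrArg List.reverse h
    simp only [List.reverse_append, List.reverse_cons, List.reverse_nil, List.nil_append,
      List.cons_append] at h2
    obtain ⟨h3, h4⟩ := append_cons_inj (by simpa using hS) (by simpa using hS') h2
    rw [List.reverse_inj] at h3 h4
    exact ⟨by rw [h4], h3⟩

theorem exists_stageTwo_eq {R₁ R₂ : List (Perm (Fin n))} (h₁ : κ ∉ R₁)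
    (h₂ : R₂ = [] ∨ ∃ L, R₂ = L ++ [κ]) (hκ : ∀ τ, conj (conj τ κ) κ = τ) :
    ∃ s, stageTwo κ s = (R₁, R₂) ∧ ∀ τ ∈ s, τ = κ ∨ τ ∈ R₁ ∨ ∃ ρ ∈ R₂, ρ ≠ κ ∧ τ = conj ρ κ := by
  induction hN : R₂.length using Nat.strong_induction_on generalizing R₁ R₂ with
  | _ N ih =>
    rcases h₂ with rfl | ⟨L, rfl⟩
    · refine ⟨R₁, by simpa [stageTwo] using stageTwo_append κ h₁ [], fun τ h => .inr (.inl h)⟩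
    · have key : ∃ P Q, L ++ [κ] = P ++ κ :: Q ∧ κ ∉ P ∧ (Q = [] ∨ ∃ L, Q = L ++ [κ]) := by
        clear ih hN
        induction L with
        | nil => exact ⟨[], [], rfl, by simp, .inl rfl⟩
        | cons τ L ihL =>
          by_cases h : τ = κ
          · exact ⟨[], L ++ [κ], by simp [h], by simp, .inr ⟨L, rfl⟩⟩
          · obtain ⟨P, Q, h1, h2, h3⟩ := ihL
            exact ⟨τ :: P, Q, by simp [h1], by simp [h2, Ne.symm h], h3⟩
      obtain ⟨P, Q, hPQ, hP, hQ⟩ := key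
      rw [hPQ] at hN ⊢
      obtain ⟨s, hs, hs'⟩ := ih Q.length (by simp at hN; omega) (not_mem_map_conj κ hP) hQ rfl
      refine ⟨R₁ ++ κ :: s, ?_, ?_⟩
      · rw [stageTwo_append κ h₁, stageTwo_cons_self, hs]
        simp [Function.comp_def, hκ]
      · intro τ hτ
        rw [List.mem_append, List.mem_cons] at hτ
        rcases hτ with h | h | h
        · exact .inr (.inl h)
        · exact .inl h
        · rcases hs' τ h with h | h | ⟨ρ, h1, h2⟩
          · exact .inl h
          · obtain ⟨ρ, h1, rfl⟩ := List.mem_map.1 h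
            exact .inr (.inr ⟨ρ, by simp [h1], fun h2 => hP (h2 ▸ h1), rfl⟩)
          · exact .inr (.inr ⟨ρ, by simp [h1], h2⟩)

end stageTwo

/-! ### Monotone lists relative to an order -/

/-- `τ` is a transposition whose larger element, in the order encoded by `e`, is the one in
position `k`.  Both elements are given by their positions. -/
def IsTranspAt (e : Perm (Fin n)) (k : Fin n) (τ : Perm (Fin n)) : Prop :=
  ∃ a, a < k ∧ τ = swap (e a) (e k)

/-- `L` is a list of transpositions that is monotone relative to the order encoded by `e`. -/
def IsMonotoneFor (e : Perm (Fin n)) (L : List (Perm (Fin n))) : Prop :=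
  (∀ τ ∈ L, ∃ k, IsTranspAt e k τ) ∧
    L.Pairwise fun τ ρ => ∀ k l, IsTranspAt e k τ → IsTranspAt e l ρ → k ≤ l

theorem IsTranspAt.hasTop_iff {e : Perm (Fin n)} {k : Fin n} {τ : Perm (Fin n)}
    (h : IsTranspAt e k τ) (l : Fin n) : HasTop e (e l) τ ↔ l = k := by
  obtain ⟨a, ha, rfl⟩ := h
  unfold HasTop
  constructor
  · intro h
    by_contra hk
    by_cases hl : l = a
    · subst hl
      simp at h
      exact absurd ha (not_lt.2 h.le)
    · rw [swap_apply_of_ne_of_ne (by simpa using hl) (by simpa using hk)] at h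
      exact lt_irrefl _ h
  · rintro rfl
    simpa using ha

theorem IsTranspAt.unique {e : Perm (Fin n)} {k l : Fin n} {τ : Perm (Fin n)}
    (h : IsTranspAt e k τ) (h' : IsTranspAt e l τ) : k = l :=
  (h'.hasTop_iff k).1 ((h.hasTop_iff k).2 rfl)

theorem isMonotoneFor_append {e : Perm (Fin n)} {L M : List (Perm (Fin n))} :
    IsMonotoneFor e (L ++ M) ↔ IsMonotoneFor e L ∧ IsMonotoneFor e M ∧
      ∀ τ ∈ L, ∀ ρ ∈ M, ∀ k l, IsTranspAt e k τ → IsTranspAt e l ρ → k ≤ l := by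
  unfold IsMonotoneFor
  rw [List.pairwise_append]
  simp only [List.mem_append, or_imp, forall_and]
  tauto

theorem isMonotoneFor_of_forall {e : Perm (Fin n)} {k : Fin n} {L : List (Perm (Fin n))}
    (h : ∀ τ ∈ L, IsTranspAt e k τ) : IsMonotoneFor e L :=
  ⟨fun τ hτ => ⟨k, h τ hτ⟩, List.pairwise_of_forall_mem_list fun τ hτ ρ hρ _ _ h1 h2 =>
    (((h τ hτ).unique h1).symm.trans ((h ρ hρ).unique h2)).le⟩

/-- A monotone list splits at every position. -/
theorem IsMonotoneFor.exists_split {e : Perm (Fin n)} {L : List (Perm (Fin n))}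
    (h : IsMonotoneFor e L) (t : ℕ) :
    ∃ A C, L = A ++ C ∧ IsMonotoneFor e A ∧ IsMonotoneFor e C ∧
      (∀ τ ∈ A, ∀ k, IsTranspAt e k τ → k.val < t) ∧
      ∀ τ ∈ C, ∀ k, IsTranspAt e k τ → t ≤ k.val := by
  have key : ∃ A C, L = A ++ C ∧ (∀ τ ∈ A, ∀ k, IsTranspAt e k τ → k.val < t) ∧
      ∀ τ ∈ C, ∀ k, IsTranspAt e k τ → t ≤ k.val := by
    induction L with
    | nil => exact ⟨[], [], rfl, by simp, by simp⟩
    | cons τ L ih =>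
      have h' := h
      rw [← List.singleton_append, isMonotoneFor_append] at h'
      obtain ⟨k, hk⟩ := h.1 τ List.mem_cons_self
      by_cases hkt : k.val < t
      · obtain ⟨A, C, rfl, hA, hC⟩ := ih h'.2.1
        refine ⟨τ :: A, C, rfl, ?_, hC⟩
        intro ρ hρ l hl
        rcases List.mem_cons.1 hρ with rfl | hρ
        · exact hl.unique hk ▸ hkt
        · exact hA ρ hρ l hl
      · refine ⟨[], τ :: L, rfl, by simp, ?_⟩
        intro ρ hρ l hl
        rcases List.mem_cons.1 hρ with rfl | hρ
        · exact hl.unique hk ▸ not_lt.1 hkt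
        · exact (not_lt.1 hkt).trans (h'.2.2 τ (by simp) ρ hρ k l hk hl)
  obtain ⟨A, C, rfl, hA, hC⟩ := key
  rw [isMonotoneFor_append] at h
  exact ⟨A, C, rfl, h.1, h.2.1, hA, hC⟩

theorem isMonotone_iff (L : List (Perm (Fin n))) : IsMonotone L ↔ IsMonotoneFor 1 L := by
  constructor
  · rintro ⟨p, rfl, h1, h2⟩
    constructor
    · intro τ hτ
      obtain ⟨q, hq, rfl⟩ := List.mem_map.1 hτ
      exact ⟨q.2, q.1, h1 q hq, rfl⟩
    · rw [List.pairwise_map]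
      refine (List.pairwise_iff_forall_sublist.2 ?_)
      intro q r hqr k l hk hl
      have hq : IsTranspAt 1 q.2 (swap q.1 q.2) := ⟨q.1, h1 q (hqr.subset (by simp)), rfl⟩
      have hr : IsTranspAt 1 r.2 (swap r.1 r.2) := ⟨r.1, h1 r (hqr.subset (by simp)), rfl⟩
      rw [hk.unique hq, hl.unique hr]
      exact List.pairwise_iff_forall_sublist.1 h2 hqr
  · intro h
    induction L with
    | nil => exact ⟨[], rfl, by simp, by simp⟩
    | cons τ L ih =>
      have h' := h
      rw [← List.singleton_append, isMonotoneFor_append] at h'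
      obtain ⟨p, rfl, h1, h2⟩ := ih h'.2.1
      obtain ⟨k, a, ha, rfl⟩ := h.1 τ List.mem_cons_self
      refine ⟨(a, k) :: p, rfl, ?_, ?_⟩
      · intro q hq
        rcases List.mem_cons.1 hq with rfl | hq
        · exact ha
        · exact h1 q hq
      · rw [List.pairwise_cons]
        refine ⟨fun q hq => ?_, h2⟩
        exact h'.2.2 _ (List.mem_singleton_self _) (swap q.1 q.2)
          (List.mem_map.2 ⟨q, hq, rfl⟩) _ _ ⟨a, ha, rfl⟩ ⟨q.1, h1 q hq, rfl⟩

/-! ### Exchanging two neighbours of the order -/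

theorem loPos_lt_hiPos (j : Fin (n - 1)) : loPos j < hiPos j := by
  simp [loPos, hiPos, Fin.lt_def]

theorem lt_hiPos_iff {j : Fin (n - 1)} {a : Fin n} : a < hiPos j ↔ a < loPos j ∨ a = loPos j := by
  simp only [loPos, hiPos, Fin.lt_def, Fin.ext_iff]
  omega

section neighbours

variable (e : Perm (Fin n)) (j : Fin (n - 1))

theorem mul_simpleTransposition_lo : (e * simpleTransposition j) (loPos j) = e (hiPos j) := by
  simp [simpleTransposition]

theorem mul_simpleTransposition_hi : (e * simpleTransposition j) (hiPos j) = e (loPos j) := by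
  simp [simpleTransposition]

theorem mul_simpleTransposition_of_ne {k : Fin n} (h1 : k ≠ loPos j) (h2 : k ≠ hiPos j) :
    (e * simpleTransposition j) k = e k := by
  simp [simpleTransposition, swap_apply_of_ne_of_ne h1 h2]

theorem mul_simpleTransposition_mul_self :
    e * simpleTransposition j * simpleTransposition j = e := by
  simp [simpleTransposition, mul_assoc]

/-- The transposition of the two neighbours. -/
abbrev neighbourSwap : Perm (Fin n) := swap (e (loPos j)) (e (hiPos j))

theorem isTranspAt_neighbourSwap : IsTranspAt e (hiPos j) (neighbourSwap e j) :=
  ⟨loPos j, loPos_lt_hiPos j, rfl⟩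

theorem not_isTranspAt_lo_neighbourSwap : ¬ IsTranspAt e (loPos j) (neighbourSwap e j) := fun h =>
  (loPos_lt_hiPos j).ne (h.unique (isTranspAt_neighbourSwap e j))

variable {e j}

theorem isTranspAt_mul_lo_iff {τ : Perm (Fin n)} :
    IsTranspAt (e * simpleTransposition j) (loPos j) τ ↔
      IsTranspAt e (hiPos j) τ ∧ τ ≠ neighbourSwap e j := by
  unfold IsTranspAt
  rw [mul_simpleTransposition_lo]
  constructor
  · rintro ⟨a, ha, rfl⟩
    have h2 := ha.trans (loPos_lt_hiPos j)
    rw [mul_simpleTransposition_of_ne e j ha.ne h2.ne]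
    refine ⟨⟨a, h2, rfl⟩, fun h => ha.ne ?_⟩
    have := congrArg (fun π => π (e (hiPos j))) h
    simpa using this
  · rintro ⟨⟨a, ha, rfl⟩, h⟩
    rcases lt_hiPos_iff.1 ha with h' | rfl
    · exact ⟨a, h', by rw [mul_simpleTransposition_of_ne e j h'.ne ha.ne]⟩
    · exact absurd rfl h

theorem isTranspAt_mul_hi_iff {τ : Perm (Fin n)} :
    IsTranspAt (e * simpleTransposition j) (hiPos j) τ ↔
      τ = neighbourSwap e j ∨ IsTranspAt e (loPos j) τ := by
  unfold IsTranspAt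
  rw [mul_simpleTransposition_hi]
  constructor
  · rintro ⟨a, ha, rfl⟩
    rcases lt_hiPos_iff.1 ha with h' | rfl
    · exact .inr ⟨a, h', by rw [mul_simpleTransposition_of_ne e j h'.ne ha.ne]⟩
    · exact .inl (by rw [mul_simpleTransposition_lo, swap_comm])
  · rintro (rfl | ⟨a, ha, rfl⟩)
    · exact ⟨loPos j, loPos_lt_hiPos j, by rw [mul_simpleTransposition_lo, swap_comm]⟩
    · have h2 := ha.trans (loPos_lt_hiPos j)
      exact ⟨a, h2, by rw [mul_simpleTransposition_of_ne e j ha.ne h2.ne]⟩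

theorem IsTranspAt.mul_simpleTransposition {k : Fin n} {τ : Perm (Fin n)}
    (h : IsTranspAt e k τ) (h1 : k ≠ loPos j) (h2 : k ≠ hiPos j) :
    IsTranspAt (e * simpleTransposition j) k τ := by
  obtain ⟨a, ha, rfl⟩ := h
  refine ⟨simpleTransposition j a, ?_, ?_⟩
  · by_cases h3 : a = loPos j
    · subst h3
      simp only [simpleTransposition, swap_apply_left]
      simp only [loPos, hiPos, Fin.lt_def, ne_eq, Fin.ext_iff] at *
      omega
    · by_cases h4 : a = hiPos j
      · subst h4
        simp only [simpleTransposition, swap_apply_right]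
        exact (loPos_lt_hiPos j).trans ha
      · rwa [simpleTransposition, swap_apply_of_ne_of_ne h3 h4]
  · rw [mul_simpleTransposition_of_ne e j h1 h2, ← Perm.mul_apply,
      mul_simpleTransposition_mul_self]

theorem conj_neighbourSwap_of_hi {τ : Perm (Fin n)} (h : IsTranspAt e (hiPos j) τ)
    (h' : τ ≠ neighbourSwap e j) : IsTranspAt e (loPos j) (conj τ (neighbourSwap e j)) := by
  obtain ⟨a, ha, rfl⟩ := h
  rcases lt_hiPos_iff.1 ha with h2 | rfl
  · refine ⟨a, h2, ?_⟩
    rw [conj_swap, swap_inv, swap_apply_right, swap_apply_of_ne_of_ne] <;> simp [h2.ne, ha.ne]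
  · exact absurd rfl h'

theorem conj_neighbourSwap_of_lo {τ : Perm (Fin n)} (h : IsTranspAt e (loPos j) τ) :
    IsTranspAt e (hiPos j) (conj τ (neighbourSwap e j)) := by
  obtain ⟨a, ha, rfl⟩ := h
  have h2 := ha.trans (loPos_lt_hiPos j)
  refine ⟨a, h2, ?_⟩
  rw [conj_swap, swap_inv, swap_apply_left, swap_apply_of_ne_of_ne] <;> simp [h2.ne, ha.ne]

theorem conj_of_lo_of_hi {τ σ : Perm (Fin n)} (hτ : IsTranspAt e (loPos j) τ)
    (hσ : IsTranspAt e (hiPos j) σ) : IsTranspAt e (hiPos j) (conj σ τ) := by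
  obtain ⟨a, ha, rfl⟩ := hτ
  obtain ⟨b, hb, rfl⟩ := hσ
  have h2 := ha.trans (loPos_lt_hiPos j)
  have h3 : (swap (e a) (e (loPos j))) (e (hiPos j)) = e (hiPos j) :=
    swap_apply_of_ne_of_ne (by simp [h2.ne']) (by simp [(loPos_lt_hiPos j).ne'])
  refine ⟨swap a (loPos j) b, ?_, ?_⟩
  · by_cases h4 : b = a
    · subst h4; rw [swap_apply_left]; exact loPos_lt_hiPos j
    · by_cases h5 : b = loPos j
      · subst h5; rw [swap_apply_right]; exact h2
      · rwa [swap_apply_of_ne_of_ne h4 h5]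
  · rw [conj_swap, swap_inv, h3, e.injective.map_swap]

theorem conj_conj_of_isTranspAt {k : Fin n} {τ : Perm (Fin n)} (hτ : IsTranspAt e k τ)
    (σ : Perm (Fin n)) : conj (conj σ τ) τ = σ := by
  obtain ⟨a, ha, rfl⟩ := hτ
  exact conj_conj_swap _ _ _

theorem stageOne_hi {s₁ s₂ : List (Perm (Fin n))} (h₁ : ∀ τ ∈ s₁, IsTranspAt e (loPos j) τ)
    (h₂ : ∀ τ ∈ s₂, IsTranspAt e (hiPos j) τ) :
    ∀ τ ∈ stageOne s₁ s₂, IsTranspAt e (hiPos j) τ := by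
  induction s₁ with
  | nil => exact h₂
  | cons τ s₁ ih =>
    rw [stageOne_cons]
    intro σ hσ
    obtain ⟨ρ, hρ, rfl⟩ := List.mem_map.1 hσ
    exact conj_of_lo_of_hi (h₁ τ List.mem_cons_self) (ih (fun τ h => h₁ τ (.tail _ h)) ρ hρ)

theorem exists_stageOne_eq {s₁ s : List (Perm (Fin n))} (h₁ : ∀ τ ∈ s₁, IsTranspAt e (loPos j) τ)
    (h : ∀ τ ∈ s, IsTranspAt e (hiPos j) τ) :
    ∃ s₂, stageOne s₁ s₂ = s ∧ ∀ τ ∈ s₂, IsTranspAt e (hiPos j) τ := by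
  induction s₁ generalizing s with
  | nil => exact ⟨s, rfl, h⟩
  | cons τ s₁ ih =>
    have hτ := h₁ τ List.mem_cons_self
    obtain ⟨s₂, h2, h3⟩ := ih (s := s.map fun σ => conj σ τ) (fun τ h => h₁ τ (.tail _ h)) (by
      intro σ hσ
      obtain ⟨ρ, hρ, rfl⟩ := List.mem_map.1 hσ
      exact conj_of_lo_of_hi hτ (h ρ hρ))
    refine ⟨s₂, ?_, h3⟩
    rw [stageOne_cons, h2, List.map_map]
    conv_rhs => rw [← List.map_id s]
    exact List.map_congr_left fun σ _ => conj_conj_of_isTranspAt hτ σ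

end neighbours

/-! ### The elementary reordering -/

/-- The list `A ++ X ++ Y ++ C` is monotone relative to the order encoded by `e`, and `X`, `Y` are
its blocks of transpositions with larger element in position `j` and `j + 1`. -/
structure IsBlocks (e : Perm (Fin n)) (j : Fin (n - 1)) (A X Y C : List (Perm (Fin n))) :
    Prop where
  left : IsMonotoneFor e A
  left_lt : ∀ τ ∈ A, ∃ k, k < loPos j ∧ IsTranspAt e k τ
  lo : ∀ τ ∈ X, IsTranspAt e (loPos j) τ
  hi : ∀ τ ∈ Y, IsTranspAt e (hiPos j) τ
  right : IsMonotoneFor e C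
  right_gt : ∀ τ ∈ C, ∃ k, hiPos j < k ∧ IsTranspAt e k τ

section blocks

variable {e : Perm (Fin n)} {j : Fin (n - 1)} {A X Y C A' X' Y' C' : List (Perm (Fin n))}

theorem IsBlocks.isMonotoneFor (h : IsBlocks e j A X Y C) :
    IsMonotoneFor e (A ++ (X ++ (Y ++ C))) := by
  have hlt := loPos_lt_hiPos j
  simp only [isMonotoneFor_append, List.mem_append]
  refine ⟨h.left, ⟨isMonotoneFor_of_forall h.lo, ⟨isMonotoneFor_of_forall h.hi, h.right, ?_⟩, ?_⟩,
    ?_⟩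
  · intro τ hτ ρ hρ k l hk hl
    obtain ⟨l', h1, h2⟩ := h.right_gt ρ hρ
    rw [hk.unique (h.hi τ hτ), hl.unique h2]
    exact h1.le
  · rintro τ hτ ρ (hρ | hρ) k l hk hl
    · rw [hk.unique (h.lo τ hτ), hl.unique (h.hi ρ hρ)]
      exact hlt.le
    · obtain ⟨l', h1, h2⟩ := h.right_gt ρ hρ
      rw [hk.unique (h.lo τ hτ), hl.unique h2]
      exact (hlt.trans h1).le
  · rintro τ hτ ρ hρ k l hk hl
    obtain ⟨k', h1, h2⟩ := h.left_lt τ hτ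
    rw [hk.unique h2]
    rcases hρ with hρ | hρ | hρ
    · rw [hl.unique (h.lo ρ hρ)]
      exact h1.le
    · rw [hl.unique (h.hi ρ hρ)]
      exact (h1.trans hlt).le
    · obtain ⟨l', h3, h4⟩ := h.right_gt ρ hρ
      rw [hl.unique h4]
      exact (h1.trans (hlt.trans h3)).le

theorem IsMonotoneFor.exists_isBlocks {L : List (Perm (Fin n))} (h : IsMonotoneFor e L)
    (j : Fin (n - 1)) : ∃ A X Y C, L = A ++ (X ++ (Y ++ C)) ∧ IsBlocks e j A X Y C := by
  obtain ⟨A, M, rfl, hA, hM, hA', hM'⟩ := h.exists_split j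
  obtain ⟨X, M, rfl, hX, hM, hX', hM''⟩ := hM.exists_split (j + 1)
  obtain ⟨Y, C, rfl, hY, hC, hY', hC'⟩ := hM.exists_split (j + 2)
  refine ⟨A, X, Y, C, rfl, hA, ?_, ?_, ?_, hC, ?_⟩
  · intro τ hτ
    obtain ⟨k, hk⟩ := hA.1 τ hτ
    exact ⟨k, hA' τ hτ k hk, hk⟩
  · intro τ hτ
    obtain ⟨k, hk⟩ := hX.1 τ hτ
    have h1 := hX' τ hτ k hk
    have h2 := hM' τ (by simp [hτ]) k hk
    have : k = loPos j := Fin.ext (by simp only [loPos]; omega)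
    exact this ▸ hk
  · intro τ hτ
    obtain ⟨k, hk⟩ := hY.1 τ hτ
    have h1 := hY' τ hτ k hk
    have h2 := hM'' τ (by simp [hτ]) k hk
    have : k = hiPos j := Fin.ext (by simp only [hiPos]; omega)
    exact this ▸ hk
  · intro τ hτ
    obtain ⟨k, hk⟩ := hC.1 τ hτ
    have h1 := hC' τ hτ k hk
    exact ⟨k, by simp only [hiPos, Fin.lt_def]; omega, hk⟩

theorem append_inj_of_forall {α : Type*} (p : α → Prop) {L L' M M' : List α}
    (hL : ∀ a ∈ L, p a) (hL' : ∀ a ∈ L', p a) (hM : ∀ a ∈ M, ¬ p a) (hM' : ∀ a ∈ M', ¬ p a)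
    (h : L ++ M = L' ++ M') : L = L' ∧ M = M' := by
  classical
  have key : ∀ {L M : List α}, (∀ a ∈ L, p a) → (∀ a ∈ M, ¬ p a) →
      (L ++ M).filter (fun a => decide (p a)) = L := by
    intro L M hL hM
    rw [List.filter_append, List.filter_eq_self.2 (by simpa using hL),
      List.filter_eq_nil_iff.2 (by simpa using hM), List.append_nil]
  have h1 : L = L' := by rw [← key hL hM, h, key hL' hM']
  subst h1
  exact ⟨rfl, List.append_cancel_left h⟩

theorem IsBlocks.inj (h : IsBlocks e j A X Y C) (h' : IsBlocks e j A' X' Y' C')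
    (heq : A ++ (X ++ (Y ++ C)) = A' ++ (X' ++ (Y' ++ C'))) :
    A = A' ∧ X = X' ∧ Y = Y' ∧ C = C' := by
  have hlt := loPos_lt_hiPos j
  have hA : ∀ {A X Y C}, IsBlocks e j A X Y C →
      ∀ τ ∈ X ++ (Y ++ C), ¬ ∃ k, k < loPos j ∧ IsTranspAt e k τ := by
    rintro A X Y C h τ hτ ⟨k, hk, hk'⟩
    simp only [List.mem_append] at hτ
    rcases hτ with hτ | hτ | hτ
    · exact hk.ne (hk'.unique (h.lo τ hτ))
    · exact (hk.trans hlt).ne (hk'.unique (h.hi τ hτ))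
    · obtain ⟨l, h1, h2⟩ := h.right_gt τ hτ
      exact (hk.trans (hlt.trans h1)).ne (hk'.unique h2)
  have hX : ∀ {A X Y C}, IsBlocks e j A X Y C →
      ∀ τ ∈ Y ++ C, ¬ IsTranspAt e (loPos j) τ := by
    rintro A X Y C h τ hτ hk'
    simp only [List.mem_append] at hτ
    rcases hτ with hτ | hτ
    · exact hlt.ne (hk'.unique (h.hi τ hτ))
    · obtain ⟨l, h1, h2⟩ := h.right_gt τ hτ
      exact (hlt.trans h1).ne (hk'.unique h2)
  have hY : ∀ {A X Y C}, IsBlocks e j A X Y C → ∀ τ ∈ C, ¬ IsTranspAt e (hiPos j) τ := by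
    rintro A X Y C h τ hτ hk'
    obtain ⟨l, h1, h2⟩ := h.right_gt τ hτ
    exact h1.ne (hk'.unique h2)
  obtain ⟨rfl, h1⟩ := append_inj_of_forall _ h.left_lt h'.left_lt (hA h) (hA h') heq
  obtain ⟨rfl, h2⟩ := append_inj_of_forall _ h.lo h'.lo (hX h) (hX h') h1
  obtain ⟨rfl, h3⟩ := append_inj_of_forall _ h.hi h'.hi (hY h) (hY h') h2
  exact ⟨rfl, rfl, rfl, h3⟩

theorem IsMonotoneFor.mul_simpleTransposition {L : List (Perm (Fin n))} (h : IsMonotoneFor e L)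
    (h' : ∀ τ ∈ L, ∃ k, k ≠ loPos j ∧ k ≠ hiPos j ∧ IsTranspAt e k τ) :
    IsMonotoneFor (e * simpleTransposition j) L := by
  refine ⟨fun τ hτ => ?_, ?_⟩
  · obtain ⟨k, h1, h2, h3⟩ := h' τ hτ
    exact ⟨k, h3.mul_simpleTransposition h1 h2⟩
  · refine h.2.imp_of_mem ?_
    intro τ ρ hτ hρ hle k l hk hl
    obtain ⟨k', h1, h2, h3⟩ := h' τ hτ
    obtain ⟨l', h4, h5, h6⟩ := h' ρ hρ
    rw [hk.unique (h3.mul_simpleTransposition h1 h2), hl.unique (h6.mul_simpleTransposition h4 h5)]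
    exact hle _ _ h3 h6

/-- The blocks outside positions `j`, `j + 1` keep their shape when the two neighbours are
exchanged. -/
theorem IsBlocks.exchange (h : IsBlocks e j A X Y C)
    (hX : ∀ τ ∈ X', IsTranspAt (e * simpleTransposition j) (loPos j) τ)
    (hY : ∀ τ ∈ Y', IsTranspAt (e * simpleTransposition j) (hiPos j) τ) :
    IsBlocks (e * simpleTransposition j) j A X' Y' C := by
  have hlt := loPos_lt_hiPos j
  refine ⟨h.left.mul_simpleTransposition ?_, ?_, hX, hY, h.right.mul_simpleTransposition ?_, ?_⟩
  · intro τ hτ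
    obtain ⟨k, h1, h2⟩ := h.left_lt τ hτ
    exact ⟨k, h1.ne, (h1.trans hlt).ne, h2⟩
  · intro τ hτ
    obtain ⟨k, h1, h2⟩ := h.left_lt τ hτ
    exact ⟨k, h1, h2.mul_simpleTransposition h1.ne (h1.trans hlt).ne⟩
  · intro τ hτ
    obtain ⟨k, h1, h2⟩ := h.right_gt τ hτ
    exact ⟨k, (hlt.trans h1).ne', h1.ne', h2⟩
  · intro τ hτ
    obtain ⟨k, h1, h2⟩ := h.right_gt τ hτ
    exact ⟨k, h1, h2.mul_simpleTransposition (hlt.trans h1).ne' h1.ne'⟩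

theorem takeWhile_append_of_forall {α : Type*} {p : α → Bool} {L M : List α}
    (hL : ∀ a ∈ L, p a = true) (hM : ∀ a ∈ M, p a = false) :
    (L ++ M).takeWhile p = L ∧ (L ++ M).dropWhile p = M := by
  have h1 : M.takeWhile p = [] ∧ M.dropWhile p = M := by
    cases M with
    | nil => simp
    | cons a M => simp [hM a List.mem_cons_self]
  rw [List.takeWhile_append_of_pos hL, List.dropWhile_append_of_pos hL, h1.1, h1.2]
  simp

theorem IsBlocks.elementaryReorder_eq (h : IsBlocks e j A X Y C) :
    elementaryReorder e j (A ++ (X ++ (Y ++ C))) =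
      A ++ ((stageTwo (neighbourSwap e j) (stageOne X Y)).1 ++
        (((stageTwo (neighbourSwap e j) (stageOne X Y)).2 ++ X) ++ C)) := by
  have hlt := loPos_lt_hiPos j
  have hC : ∀ τ ∈ C, ¬ HasTop e (e (loPos j)) τ ∧ ¬ HasTop e (e (hiPos j)) τ := by
    intro τ hτ
    obtain ⟨k, h1, h2⟩ := h.right_gt τ hτ
    rw [h2.hasTop_iff, h2.hasTop_iff]
    exact ⟨(hlt.trans h1).ne, h1.ne⟩
  have hX : ∀ τ ∈ X, HasTop e (e (loPos j)) τ := fun τ hτ => ((h.lo τ hτ).hasTop_iff _).2 rfl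
  have hY : ∀ τ ∈ Y, HasTop e (e (hiPos j)) τ := fun τ hτ => ((h.hi τ hτ).hasTop_iff _).2 rfl
  have hY' : ∀ τ ∈ Y, ¬ HasTop e (e (loPos j)) τ := fun τ hτ =>
    fun h' => hlt.ne (((h.hi τ hτ).hasTop_iff _).1 h')
  have hA : ∀ τ ∈ A, ¬ HasTop e (e (loPos j)) τ ∧ ¬ HasTop e (e (hiPos j)) τ := by
    intro τ hτ
    obtain ⟨k, h1, h2⟩ := h.left_lt τ hτ
    rw [h2.hasTop_iff, h2.hasTop_iff]
    exact ⟨h1.ne', (h1.trans hlt).ne'⟩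
  -- the two inner scans
  have t2 := takeWhile_append_of_forall (p := fun τ => decide (HasTop e (e (loPos j)) τ))
    (L := X) (M := Y ++ C) (by simpa using hX) (by
      intro τ hτ
      rcases List.mem_append.1 hτ with hτ | hτ
      · simpa using hY' τ hτ
      · simpa using (hC τ hτ).1)
  have t3 := takeWhile_append_of_forall (p := fun τ => decide (HasTop e (e (hiPos j)) τ))
    (L := Y) (M := C) (by simpa using hY) (by
      intro τ hτ
      simpa using (hC τ hτ).2)
  -- if both strings are empty, the first scan runs to the end of the list
  by_cases hXY : X = [] ∧ Y = []
  · obtain ⟨rfl, rfl⟩ := hXY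
    have t1 := takeWhile_append_of_forall (L := A ++ C) (M := [])
      (p := fun τ => decide (¬ HasTop e (e (loPos j)) τ ∧ ¬ HasTop e (e (hiPos j)) τ)) (by
        intro τ hτ
        rcases List.mem_append.1 hτ with hτ | hτ
        · simpa using hA τ hτ
        · simpa using hC τ hτ) (by simp)
    rw [List.append_nil] at t1
    simp only [elementaryReorder, List.nil_append, t1.1, t1.2]
    simp [stageOne, stageTwo]
  · have t1 : (A ++ (X ++ (Y ++ C))).takeWhile
          (fun τ => decide (¬ HasTop e (e (loPos j)) τ ∧ ¬ HasTop e (e (hiPos j)) τ)) = A ∧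
        (A ++ (X ++ (Y ++ C))).dropWhile
          (fun τ => decide (¬ HasTop e (e (loPos j)) τ ∧ ¬ HasTop e (e (hiPos j)) τ)) =
            X ++ (Y ++ C) := by
      rw [List.takeWhile_append_of_pos (by simpa using hA),
        List.dropWhile_append_of_pos (by simpa using hA)]
      cases X with
      | cons τ X => simp [hX τ List.mem_cons_self]
      | nil =>
        cases Y with
        | cons τ Y => simp [hY τ List.mem_cons_self]
        | nil => simp at hXY
    simp only [elementaryReorder, t1.1, t1.2, t2.1, t2.2, t3.1, t3.2]
    simp

/-- The blocks produced by the elementary reordering. -/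
theorem IsBlocks.elementaryReorder_isBlocks (h : IsBlocks e j A X Y C) :
    IsBlocks (e * simpleTransposition j) j A (stageTwo (neighbourSwap e j) (stageOne X Y)).1
      ((stageTwo (neighbourSwap e j) (stageOne X Y)).2 ++ X) C := by
  have hs := stageOne_hi h.lo h.hi
  refine h.exchange (fun τ hτ => ?_) (fun τ hτ => ?_)
  · exact isTranspAt_mul_lo_iff.2 ⟨hs τ (mem_stageTwo_fst _ hτ),
      fun h' => not_mem_stageTwo_fst _ _ (h' ▸ hτ)⟩
  · rw [isTranspAt_mul_hi_iff]
    rcases List.mem_append.1 hτ with hτ | hτ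
    · rcases mem_stageTwo_snd _ hτ with rfl | ⟨ρ, hρ, h1, rfl⟩
      · exact .inl rfl
      · exact .inr (conj_neighbourSwap_of_hi (hs ρ hρ) h1)
    · exact .inr (h.lo τ hτ)

end blocks

section reorder

variable (e : Perm (Fin n)) (j : Fin (n - 1))

theorem prodLR_elementaryReorder {L : List (Perm (Fin n))} (h : IsMonotoneFor e L) :
    prodLR (elementaryReorder e j L) = prodLR L := by
  obtain ⟨A, X, Y, C, rfl, hb⟩ := h.exists_isBlocks j
  rw [hb.elementaryReorder_eq]
  have h1 := prodLR_stageTwo (neighbourSwap e j) (stageOne X Y)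
  have h2 := prodLR_stageOne X Y
  simp only [prodLR_append] at h1 h2 ⊢
  rw [mul_assoc (prodLR C), mul_assoc (prodLR X), h1, h2, ← mul_assoc (prodLR C)]

theorem length_elementaryReorder {L : List (Perm (Fin n))} (h : IsMonotoneFor e L) :
    (elementaryReorder e j L).length = L.length := by
  obtain ⟨A, X, Y, C, rfl, hb⟩ := h.exists_isBlocks j
  rw [hb.elementaryReorder_eq]
  have h1 := length_stageTwo (neighbourSwap e j) (stageOne X Y)
  have h2 := length_stageOne X Y
  simp only [List.length_append]
  omega

/-- The elementary reordering is a bijection.  Its inverse reads off the two stages: the new block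
of position `j + 1` is cut after its last neighbour transposition, which separates string 1 from
what stage 2 has moved. -/
theorem bijOn_elementaryReorder :
    Set.BijOn (elementaryReorder e j) {L | IsMonotoneFor e L}
      {L | IsMonotoneFor (e * simpleTransposition j) L} := by
  refine ⟨?_, ?_, ?_⟩
  · intro L hL
    obtain ⟨A, X, Y, C, rfl, hb⟩ := hL.exists_isBlocks j
    rw [Set.mem_ofPred_eq, hb.elementaryReorder_eq]
    exact hb.elementaryReorder_isBlocks.isMonotoneFor
  · intro L hL L' hL' heq
    obtain ⟨A, X, Y, C, rfl, hb⟩ := hL.exists_isBlocks j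
    obtain ⟨A', X', Y', C', rfl, hb'⟩ := hL'.exists_isBlocks j
    have heq' : elementaryReorder e j _ = elementaryReorder e j _ := heq
    rw [hb.elementaryReorder_eq, hb'.elementaryReorder_eq] at heq'
    obtain ⟨rfl, h1, h2, rfl⟩ :=
      hb.elementaryReorder_isBlocks.inj hb'.elementaryReorder_isBlocks heq'
    obtain ⟨h3, rfl⟩ := split_last_inj _
      (fun h => not_isTranspAt_lo_neighbourSwap e j (hb.lo _ h))
      (fun h => not_isTranspAt_lo_neighbourSwap e j (hb'.lo _ h))
      (stageTwo_snd_eq _ _) (stageTwo_snd_eq _ _) h2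
    rw [stageOne_injective X (stageTwo_injective _ (Prod.ext h1 h3))]
  · intro L hL
    obtain ⟨A, R, Z, C, rfl, hb⟩ := IsMonotoneFor.exists_isBlocks hL j
    obtain ⟨S, X, rfl, hX, hS⟩ := exists_split_last (neighbourSwap e j) Z
    have hX' : ∀ τ ∈ X, IsTranspAt e (loPos j) τ := fun τ hτ =>
      (isTranspAt_mul_hi_iff.1 (hb.hi τ (by simp [hτ]))).resolve_left fun h => hX (h ▸ hτ)
    obtain ⟨s, hs, hs'⟩ := exists_stageTwo_eq (neighbourSwap e j) (R₁ := R) (R₂ := S)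
      (fun h => (isTranspAt_mul_lo_iff.1 (hb.lo _ h)).2 rfl) hS fun τ => conj_conj_swap _ _ _
    obtain ⟨Y, hY, hY'⟩ := exists_stageOne_eq (s := s) hX' (by
      intro τ hτ
      rcases hs' τ hτ with rfl | h | ⟨ρ, h1, h2, rfl⟩
      · exact isTranspAt_neighbourSwap e j
      · exact (isTranspAt_mul_lo_iff.1 (hb.lo _ h)).1
      · exact conj_neighbourSwap_of_lo
          ((isTranspAt_mul_hi_iff.1 (hb.hi ρ (by simp [h1]))).resolve_left h2))
    have hb' : IsBlocks e j A X Y C := by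
      have := hb.exchange (X' := X) (Y' := Y)
      rw [mul_simpleTransposition_mul_self] at this
      exact this hX' hY'
    refine ⟨A ++ (X ++ (Y ++ C)), hb'.isMonotoneFor, ?_⟩
    rw [hb'.elementaryReorder_eq, hY, hs]

theorem reorderAlong_spec (w : List (Fin (n - 1))) :
    Set.BijOn (reorderAlong e w) {L | IsMonotoneFor e L}
        {L | IsMonotoneFor (e * (w.map simpleTransposition).prod) L} ∧
      ∀ L, IsMonotoneFor e L → prodLR (reorderAlong e w L) = prodLR L ∧
        (reorderAlong e w L).length = L.length := by
  induction w generalizing e with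
  | nil => 
    refine ⟨?_, fun L _ => ⟨rfl, rfl⟩⟩
    rw [List.map_nil, List.prod_nil, mul_one]
    exact Set.bijOn_id _
  | cons j w ih =>
    obtain ⟨h1, h2⟩ := ih (e * simpleTransposition j)
    have hj := bijOn_elementaryReorder e j
    refine ⟨?_, fun L hL => ?_⟩
    · have h3 := h1.comp hj
      rwa [mul_assoc] at h3
    · obtain ⟨h4, h5⟩ := h2 _ (hj.mapsTo hL)
      rw [reorderAlong, h4, h5]
      exact ⟨prodLR_elementaryReorder e j hL, length_elementaryReorder e j hL⟩

theorem reorder_spec (W : SimpleWords n) :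
    Set.BijOn (reorder W e) {L | IsMonotoneFor e L} {L | IsMonotone L} ∧
      ∀ L, IsMonotoneFor e L → prodLR (reorder W e L) = prodLR L ∧
        (reorder W e L).length = L.length := by
  have h := reorderAlong_spec e (W e).1
  have hprod : e * ((W e).1.map simpleTransposition).prod = 1 := by
    have h1 := (W e).2
    rw [prodLR_eq] at h1
    have h2 : (((W e).1.map simpleTransposition).reverse.prod)⁻¹ =
        ((W e).1.map simpleTransposition).prod := by
      rw [List.prod_inv_reverse, List.map_reverse, List.reverse_reverse, List.map_map]
      rfl
    rw [← h2, h1, mul_inv_cancel]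
  rw [hprod] at h
  simp only [← isMonotone_iff] at h
  exact h

end reorder

/-! ### The leftward shuffle -/

/-- One step of the leftward shuffle. -/
theorem shuffle_append_singleton (f : List (Perm (Fin n))) (τ : Perm (Fin n)) :
    shuffle (f ++ [τ]) =
      if τ ∈ (shuffle f).1 then ((shuffle f).1, (shuffle f).2 ++ [τ])
      else ((shuffle f).1 ++ [τ], (shuffle f).2.map fun σ => conj σ τ) := by
  simp only [shuffle, List.foldl_append, List.foldl_cons, List.foldl_nil, pushLeft_eq]

theorem shuffle_append_of_forall_mem (f t : List (Perm (Fin n)))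
    (h : ∀ τ ∈ t, τ ∈ (shuffle f).1) :
    shuffle (f ++ t) = ((shuffle f).1, (shuffle f).2 ++ t) := by
  induction t using List.reverseRecOn with
  | nil => simp
  | append_singleton t τ ih =>
    have ih := ih fun τ hτ => h τ (by simp [hτ])
    rw [← List.append_assoc, shuffle_append_singleton, ih, if_pos (h τ (by simp))]
    simp

theorem length_shuffle (f : List (Perm (Fin n))) :
    (shuffle f).1.length + (shuffle f).2.length = f.length := by
  induction f using List.reverseRecOn with
  | nil => rfl
  | append_singleton f τ ih =>
    rw [shuffle_append_singleton]
    split_ifs <;> simp <;> omega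

theorem prodLR_shuffle {f : List (Perm (Fin n))} (hf : ∀ τ ∈ f, τ * τ = 1) :
    prodLR (shuffle f).2 * prodLR (shuffle f).1 = prodLR f := by
  induction f using List.reverseRecOn with
  | nil => simp [shuffle, prodLR]
  | append_singleton f τ ih =>
    have ih := ih fun ρ hρ => hf ρ (by simp [hρ])
    have hτ := hf τ (by simp)
    rw [shuffle_append_singleton]
    split_ifs
    · simp [prodLR_append, ← ih, prodLR, mul_assoc]
    · simp only [prodLR_append, prodLR_map_conj, ← ih, prodLR]
      rw [conj_eq, one_mul, mul_assoc (τ⁻¹ * _), ← mul_assoc τ τ, hτ, one_mul, mul_assoc τ⁻¹,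
        inv_eq_of_mul_eq_one_right hτ]

theorem mem_shuffle_fst (f : List (Perm (Fin n))) (τ : Perm (Fin n)) :
    τ ∈ (shuffle f).1 ↔ τ ∈ f := by
  induction f using List.reverseRecOn with
  | nil => simp [shuffle]
  | append_singleton f ρ ih =>
    rw [shuffle_append_singleton, List.mem_append, ← ih, List.mem_singleton]
    split_ifs with h
    · simp only [iff_self_or]
      rintro rfl
      exact h
    · simp

theorem nodup_shuffle_fst (f : List (Perm (Fin n))) : (shuffle f).1.Nodup := by
  induction f using List.reverseRecOn with
  | nil => simp [shuffle]
  | append_singleton f ρ ih =>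
    rw [shuffle_append_singleton]
    split_ifs with h
    · exact ih
    · rw [← List.concat_eq_append]
      exact ih.concat h

section star

variable [NeZero n]

/-- `τ = (a n)` with `a < n`. -/
def IsStar (τ : Perm (Fin n)) : Prop := ∃ a : Fin n, a < ⊤ ∧ τ = swap a ⊤

theorem IsStar.apply_top_ne {τ : Perm (Fin n)} (h : IsStar τ) : τ ⊤ ≠ ⊤ := by
  obtain ⟨a, ha, rfl⟩ := h
  simpa using ha.ne

theorem IsStar.mul_self {τ : Perm (Fin n)} (h : IsStar τ) : τ * τ = 1 := by
  obtain ⟨a, ha, rfl⟩ := h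
  exact swap_mul_self _ _

theorem val_top : (⊤ : Fin n).val = n - 1 := by
  have h : (⟨n - 1, Nat.sub_one_lt (NeZero.ne n)⟩ : Fin n) ≤ ⊤ := le_top
  have := (⊤ : Fin n).isLt
  rw [Fin.le_def] at h
  simp only at h
  omega

/-- During the shuffle, a factor that is not underlined is either a repetition of an underlined
one or fixes `n`, and it only moves `n` and symbols already met. -/
theorem shuffle_snd_spec {f : List (Perm (Fin n))} (hf : ∀ τ ∈ f, IsStar τ) :
    ∀ σ ∈ (shuffle f).2, (σ ⊤ ≠ ⊤ → σ ∈ (shuffle f).1) ∧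
      ∀ i : Fin n, i < ⊤ → swap i ⊤ ∉ (shuffle f).1 → σ i = i := by
  induction f using List.reverseRecOn with
  | nil => simp [shuffle]
  | append_singleton f τ ih =>
    have hf' : ∀ τ ∈ f, IsStar τ := fun ρ hρ => hf ρ (by simp [hρ])
    have ih := ih hf'
    obtain ⟨a, ha, hτ⟩ := hf τ (by simp)
    rw [shuffle_append_singleton]
    split_ifs with h
    · intro σ hσ
      rcases List.mem_append.1 hσ with hσ | hσ
      · exact ih σ hσ
      · rw [List.mem_singleton] at hσ
        subst hσ
        refine ⟨fun _ => h, fun i hi hiu => ?_⟩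
        rw [hτ]
        refine swap_apply_of_ne_of_ne ?_ hi.ne
        rintro rfl
        exact hiu (hτ ▸ h)
    · intro ρ hρ
      obtain ⟨σ, hσ, rfl⟩ := List.mem_map.1 hρ
      obtain ⟨h1, h2⟩ := ih σ hσ
      subst hτ
      refine ⟨fun h3 => absurd ?_ h3, fun i hi hiu => ?_⟩
      · have hσa := h2 a ha h
        simp [conj_eq, hσa]
      · rw [List.mem_append, List.mem_singleton, not_or] at hiu
        have hia : i ≠ a := by rintro rfl; exact hiu.2 rfl
        simp [conj_eq, swap_apply_of_ne_of_ne hia hi.ne, h2 i hi hiu.1]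

/-- Whether the last step of the shuffle met an underlined factor can be seen from the result: if
it did, all other factors fix `n`, and otherwise the last one moves `n`. -/
theorem shuffle_injOn : Set.InjOn (shuffle (n := n)) {f | ∀ τ ∈ f, IsStar τ} := by
  intro f
  induction f using List.reverseRecOn with
  | nil =>
    intro _ g _ h
    have h1 := length_shuffle g
    rw [← h] at h1
    exact (List.length_eq_zero_iff.1 h1.symm).symm
  | append_singleton f τ ih =>
    intro hf g hg h
    -- an underlined last factor is recognised by its effect on the other factors
    have mixed : ∀ (f g : List (Perm (Fin n))) (τ ρ : Perm (Fin n)), (∀ σ ∈ f, IsStar σ) →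
        IsStar τ → IsStar ρ → τ ∉ (shuffle f).1 →
        (shuffle f).2.map (fun σ => conj σ τ) = (shuffle g).2 ++ [ρ] → False := by
      rintro f g τ ρ hf ⟨a, ha, rfl⟩ hρ h h'
      have h1 : ρ ∈ (shuffle f).2.map fun σ => conj σ (swap a ⊤) := by simp [h']
      obtain ⟨σ, hσ, rfl⟩ := List.mem_map.1 h1
      refine hρ.apply_top_ne ?_
      have := (shuffle_snd_spec hf σ hσ).2 a ha h
      simp [conj_eq, this]
    have hf' : ∀ τ ∈ f, IsStar τ := fun σ hσ => hf σ (by simp [hσ])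
    have hτ : IsStar τ := hf τ (by simp)
    cases g using List.reverseRecOn with
    | nil =>
      have h1 := length_shuffle (f ++ [τ])
      rw [h] at h1
      simp [shuffle] at h1
    | append_singleton g ρ =>
      have hg' : ∀ τ ∈ g, IsStar τ := fun σ hσ => hg σ (by simp [hσ])
      have hρ : IsStar ρ := hg ρ (by simp)
      rw [shuffle_append_singleton, shuffle_append_singleton] at h
      split_ifs at h with h1 h2 h2 <;> rw [Prod.mk.injEq] at h
      · obtain ⟨h3, h4⟩ := List.append_inj' h.2 rfl
        rw [ih hf' hg' (Prod.ext h.1 h3), h4]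
      · exact (mixed g f ρ τ hg' hρ hτ h2 h.2.symm).elim
      · exact (mixed f g τ ρ hf' hτ hρ h1 h.2).elim
      · obtain ⟨h3, h4⟩ := List.append_inj' h.1 rfl
        obtain rfl : τ = ρ := by simpa using h4
        rw [ih hf' hg' (Prod.ext h3 (List.map_injective_iff.2 (conj_injective τ) h.2))]

/-- The list `(i₁ n), …, (i_p n)` of star transpositions defined by the order
`i₁ ≺ i₂ ≺ ⋯` encoded by `e`. -/
def starList (e : Perm (Fin n)) (p : ℕ) : List (Perm (Fin n)) :=
  ((List.finRange n).take p).map fun k => swap (e k) ⊤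

theorem starList_succ (e : Perm (Fin n)) {p : ℕ} (hp : p < n) :
    starList e (p + 1) = starList e p ++ [swap (e ⟨p, hp⟩) ⊤] := by
  have h : (List.finRange n).take (p + 1) = (List.finRange n).take p ++ [⟨p, hp⟩] := by
    rw [List.take_succ_eq_append_getElem (by simpa using hp)]
    simp
  rw [starList, h, List.map_append]
  rfl

theorem length_starList (e : Perm (Fin n)) {p : ℕ} (hp : p ≤ n) : (starList e p).length = p := by
  simp [starList, hp]

theorem getElem_starList (e : Perm (Fin n)) (p : ℕ) (i : ℕ) (h : i < (starList e p).length)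
    (hi : i < n) : (starList e p)[i] = swap (e ⟨i, hi⟩) ⊤ := by
  simp [starList]

theorem mem_starList {e : Perm (Fin n)} {p : ℕ} {τ : Perm (Fin n)} :
    τ ∈ starList e p ↔ ∃ k : Fin n, k.val < p ∧ τ = swap (e k) ⊤ := by
  constructor
  · intro h
    obtain ⟨i, hi, rfl⟩ := List.getElem_of_mem h
    have hi' := hi
    simp only [starList, List.length_map, List.length_take, List.length_finRange, lt_inf_iff] at hi'
    exact ⟨⟨i, hi'.2⟩, hi'.1, getElem_starList e p i hi hi'.2⟩
  · rintro ⟨k, hk, rfl⟩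
    have hl : k.val < (starList e p).length := by simp [starList, hk]
    rw [← getElem_starList e p k hl k.isLt]
    exact List.getElem_mem hl

theorem nodup_starList (e : Perm (Fin n)) (p : ℕ) : (starList e p).Nodup := by
  refine List.Nodup.map (fun k l h => ?_) ((List.take_sublist _ _).nodup (List.nodup_finRange n))
  have := congrArg (fun π => π ⊤) h
  simpa using this

theorem starList_injOn :
    Set.InjOn (fun e : Perm (Fin n) => starList e (n - 1)) {e | e ⊤ = ⊤} := by
  intro e he e' he' h
  ext1 k
  by_cases hk : k = ⊤
  · subst hk
    exact he.trans he'.symm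
  · have h1 : k.val < n - 1 := by
      rw [← val_top (n := n)]
      exact lt_top_iff_ne_top.2 hk
    have h2 : swap (e k) ⊤ ∈ starList e (n - 1) := mem_starList.2 ⟨k, h1, rfl⟩
    have h3 : k.val < (starList e (n - 1)).length := by rwa [length_starList _ (by omega)]
    have h' : starList e (n - 1) = starList e' (n - 1) := h
    have h4 : (starList e (n - 1))[k.val]'h3 = (starList e' (n - 1))[k.val]'(h' ▸ h3) := by
      simp only [h']
    rw [getElem_starList _ _ _ _ k.isLt, getElem_starList _ _ _ _ k.isLt] at h4
    simpa using congrArg (fun π => π ⊤) h4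

theorem mem_starList_top {e : Perm (Fin n)} (he : e ⊤ = ⊤) {τ : Perm (Fin n)} :
    τ ∈ starList e (n - 1) ↔ IsStar τ := by
  rw [mem_starList, ← val_top]
  constructor
  · rintro ⟨k, hk, rfl⟩
    exact ⟨e k, lt_top_iff_ne_top.2 fun h => hk.ne
      (congrArg Fin.val (e.injective (h.trans he.symm))), rfl⟩
  · rintro ⟨a, ha, rfl⟩
    refine ⟨e.symm a, ?_, by simp⟩
    have : e.symm a ≠ ⊤ := fun h => ha.ne (by rw [← e.apply_symm_apply a, h, he])
    exact lt_top_iff_ne_top.2 this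

theorem underlinedOrder_spec {u : List (Perm (Fin n))} (hu : u.Nodup)
    (hmem : ∀ τ, τ ∈ u ↔ IsStar τ) :
    underlinedOrder u ⊤ = ⊤ ∧ starList (underlinedOrder u) (n - 1) = u := by
  set l : List (Fin n) := u.map (fun τ => τ ⊤) ++ [⊤] with hl
  have h1 : l.Nodup := by
    rw [hl, List.nodup_append]
    refine ⟨hu.map_on ?_, by simp, ?_⟩
    · intro τ hτ ρ hρ h
      obtain ⟨a, ha, rfl⟩ := (hmem τ).1 hτ
      obtain ⟨b, hb, rfl⟩ := (hmem ρ).1 hρ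
      simp only [swap_apply_right] at h
      rw [h]
    · intro a ha b hb
      obtain ⟨τ, hτ, rfl⟩ := List.mem_map.1 ha
      rw [List.mem_singleton.1 hb]
      exact ((hmem τ).1 hτ).apply_top_ne
  have h3 : ∀ x, x ∈ l := by
    intro x
    rw [hl, List.mem_append, List.mem_singleton, List.mem_map]
    by_cases hx : x = ⊤
    · exact .inr hx
    · exact .inl ⟨swap x ⊤, (hmem _).2 ⟨x, lt_top_iff_ne_top.2 hx, rfl⟩, by simp⟩
  have h2 : l.length = n := by
    have := Fintype.card_congr (h1.getEquivOfForallMemList l h3)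
    simpa using this
  have hulen : u.length = n - 1 := by
    rw [hl] at h2
    simp at h2
    omega
  have happ : ∀ (i : ℕ) (hi : i < n), underlinedOrder u ⟨i, hi⟩ = l[i]'(h2.symm ▸ hi) := by
    intro i hi
    rw [underlinedOrder, dif_pos ⟨h1, h2, h3⟩]
    rfl
  constructor
  · have h4 := happ (n - 1) (Nat.sub_one_lt (NeZero.ne n))
    have h5 : (⟨n - 1, Nat.sub_one_lt (NeZero.ne n)⟩ : Fin n) = ⊤ := Fin.ext val_top.symm
    rw [h5] at h4
    rw [h4]
    simp only [hl]
    rw [List.getElem_append_right (by simp [hulen])]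
    simp
  · refine List.ext_getElem (by rw [length_starList _ (by omega), hulen]) ?_
    intro i hi hi'
    have hin : i < n := by omega
    rw [getElem_starList _ _ _ _ hin, happ i hin]
    simp only [hl]
    rw [List.getElem_append_left (by simpa using hi')]
    obtain ⟨a, ha, h⟩ := (hmem _).1 (List.getElem_mem hi')
    rw [List.getElem_map, h]
    simp

/-- The shape of the factors that are not underlined when `p` factors `(i₁ n), …, (i_p n)` have
been underlined: a monotone list with larger elements among `i₁, …, i_p`, followed by
repetitions of underlined factors. -/
def IsPartialShuffle (e : Perm (Fin n)) (p : ℕ) (r : List (Perm (Fin n))) : Prop :=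
  ∃ r₀ t, r = r₀ ++ t ∧ IsMonotoneFor e r₀ ∧ (∀ τ ∈ r₀, ∃ k, k.val < p ∧ IsTranspAt e k τ) ∧
    ∀ τ ∈ t, τ ∈ starList e p

theorem conj_star_of_lt {e : Perm (Fin n)} (he : e ⊤ = ⊤) {k q : Fin n} (hk : k < q) (hq : q < ⊤)
    {τ : Perm (Fin n)} (h : IsTranspAt e k τ) : conj τ (swap (e q) ⊤) = τ := by
  obtain ⟨a, ha, rfl⟩ := h
  rw [conj_swap, swap_inv]
  nth_rw 1 2 [← he]
  have haq := ha.trans hk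
  rw [swap_apply_of_ne_of_ne, swap_apply_of_ne_of_ne] <;>
    simp [hk.ne, haq.ne, (hk.trans hq).ne, (haq.trans hq).ne]

theorem conj_star_star {e : Perm (Fin n)} (he : e ⊤ = ⊤) {a q : Fin n} (ha : a < q) (hq : q < ⊤) :
    conj (swap (e a) ⊤) (swap (e q) ⊤) = swap (e a) (e q) := by
  rw [conj_swap, swap_inv, swap_apply_right]
  nth_rw 1 [← he]
  rw [swap_apply_of_ne_of_ne] <;> simp [ha.ne, (ha.trans hq).ne]

theorem isPartialShuffle_shuffle {e : Perm (Fin n)} (he : e ⊤ = ⊤) {f : List (Perm (Fin n))}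
    {p : ℕ} (hp : p < n) (h : (shuffle f).1 = starList e p) :
    IsPartialShuffle e p (shuffle f).2 := by
  induction f using List.reverseRecOn generalizing p with
  | nil => exact ⟨[], [], rfl, ⟨by simp, by simp⟩, by simp, by simp⟩
  | append_singleton f τ ih =>
    rw [shuffle_append_singleton] at h ⊢
    split_ifs at h ⊢ with hτ
    · obtain ⟨r₀, t, h1, h2, h3, h4⟩ := ih hp h
      refine ⟨r₀, t ++ [τ], by simp [h1], h2, h3, ?_⟩
      intro ρ hρ
      rcases List.mem_append.1 hρ with hρ | hρ
      · exact h4 ρ hρ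
      · rw [List.mem_singleton.1 hρ]
        exact h ▸ hτ
    · cases p with
      | zero => simp [starList] at h
      | succ q =>
        rw [starList_succ e (by omega : q < n)] at h
        obtain ⟨h5, h6⟩ := List.append_inj' h rfl
        set q' : Fin n := ⟨q, by omega⟩ with hq'
        have hτq : τ = swap (e q') ⊤ := by simpa using h6
        have hqt : q' < ⊤ := by
          rw [Fin.lt_def, val_top]
          simp only [hq']
          omega
        obtain ⟨r₀, t, h1, h2, h3, h4⟩ := ih (by omega : q < n) h5
        have hr₀ : r₀.map (fun σ => conj σ τ) = r₀ := by
          conv_rhs => rw [← List.map_id r₀]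
          refine List.map_congr_left fun σ hσ => ?_
          obtain ⟨k, hk, hk'⟩ := h3 σ hσ
          rw [hτq]
          exact conj_star_of_lt he (q := q') hk hqt hk'
        have ht : ∀ σ ∈ t.map (fun σ => conj σ τ), IsTranspAt e q' σ := by
          intro σ hσ
          obtain ⟨ρ, hρ, rfl⟩ := List.mem_map.1 hσ
          obtain ⟨a, ha, rfl⟩ := mem_starList.1 (h4 ρ hρ)
          rw [hτq, conj_star_star he (q := q') ha hqt]
          exact ⟨a, ha, rfl⟩
        refine ⟨r₀ ++ t.map (fun σ => conj σ τ), [], ?_, ?_, ?_, by simp⟩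
        · rw [h1, List.map_append, hr₀, List.append_nil]
        · refine isMonotoneFor_append.2 ⟨h2, isMonotoneFor_of_forall ht, ?_⟩
          intro σ hσ ρ hρ k l hk hl
          obtain ⟨k', h7, h8⟩ := h3 σ hσ
          rw [hk.unique h8, hl.unique (ht ρ hρ)]
          exact Fin.le_def.2 h7.le
        · intro σ hσ
          rcases List.mem_append.1 hσ with hσ | hσ
          · obtain ⟨k, hk, hk'⟩ := h3 σ hσ
            exact ⟨k, by omega, hk'⟩
          · exact ⟨q', by simp [hq'], ht σ hσ⟩

theorem exists_shuffle_eq {e : Perm (Fin n)} (he : e ⊤ = ⊤) {p : ℕ} (hp : p < n)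
    {r : List (Perm (Fin n))} (h : IsPartialShuffle e p r) :
    ∃ f, (∀ τ ∈ f, IsStar τ) ∧ shuffle f = (starList e p, r) := by
  have hstar : ∀ {p}, p < n → ∀ τ ∈ starList e p, IsStar τ := by
    intro p hp τ hτ
    obtain ⟨k, hk, rfl⟩ := mem_starList.1 hτ
    exact (mem_starList_top he).1 (mem_starList.2 ⟨k, by omega, rfl⟩)
  induction p generalizing r with
  | zero =>
    obtain ⟨r₀, t, rfl, h2, h3, h4⟩ := h
    have h5 : r₀ = [] := List.eq_nil_iff_forall_not_mem.2 fun τ hτ => by simpa using h3 τ hτ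
    have h6 : t = [] := List.eq_nil_iff_forall_not_mem.2 fun τ hτ => by
      simpa [starList] using h4 τ hτ
    subst h5 h6
    exact ⟨[], by simp, rfl⟩
  | succ q ih =>
    obtain ⟨r₀, t, rfl, h2, h3, h4⟩ := h
    obtain ⟨r₁, r₂, rfl, h5, h6, h7, h8⟩ := h2.exists_split q
    set q' : Fin n := ⟨q, by omega⟩ with hq'
    have hqt : q' < ⊤ := by
      rw [Fin.lt_def, val_top]
      simp only [hq']
      omega
    have hr₁ : ∀ τ ∈ r₁, ∃ k, k.val < q ∧ IsTranspAt e k τ := by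
      intro τ hτ
      obtain ⟨k, hk⟩ := h5.1 τ hτ
      exact ⟨k, h7 τ hτ k hk, hk⟩
    have hr₂ : ∀ τ ∈ r₂, IsTranspAt e q' τ := by
      intro τ hτ
      obtain ⟨k, hk, hk'⟩ := h3 τ (by simp [hτ])
      have h9 := h8 τ hτ k hk'
      have : k = q' := Fin.ext (by simp only [hq']; omega)
      exact this ▸ hk'
    have hconj : ∀ σ, conj (conj σ (swap (e q') ⊤)) (swap (e q') ⊤) = σ :=
      fun σ => conj_conj_swap _ _ _
    obtain ⟨f, hf, hf'⟩ := ih (r := r₁ ++ r₂.map fun σ => conj σ (swap (e q') ⊤)) (by omega)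
      ⟨r₁, _, rfl, h5, hr₁, by
        intro σ hσ
        obtain ⟨ρ, hρ, rfl⟩ := List.mem_map.1 hσ
        obtain ⟨a, ha, rfl⟩ := hr₂ ρ hρ
        rw [← conj_star_star he ha hqt, hconj]
        exact mem_starList.2 ⟨a, ha, rfl⟩⟩
    have hnot : swap (e q') ⊤ ∉ (shuffle f).1 := by
      rw [hf', mem_starList]
      rintro ⟨k, hk, h⟩
      have h9 := congrArg (fun π => π ⊤) h
      simp only [swap_apply_right, EmbeddingLike.apply_eq_iff_eq] at h9
      rw [← h9] at hk
      simp [hq'] at hk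
    have hstep : shuffle (f ++ [swap (e q') ⊤]) = (starList e (q + 1), r₁ ++ r₂) := by
      rw [shuffle_append_singleton, if_neg hnot, hf', starList_succ e (by omega : q < n)]
      congr 1
      rw [List.map_append, List.map_map]
      congr 1
      · conv_rhs => rw [← List.map_id r₁]
        refine List.map_congr_left fun σ hσ => ?_
        obtain ⟨k, hk, hk'⟩ := hr₁ σ hσ
        exact conj_star_of_lt he (q := q') hk hqt hk'
      · conv_rhs => rw [← List.map_id r₂]
        exact List.map_congr_left fun σ _ => hconj σ
    refine ⟨f ++ [swap (e q') ⊤] ++ t, ?_, ?_⟩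
    · intro τ hτ
      simp only [List.mem_append, List.mem_singleton] at hτ
      rcases hτ with (hτ | rfl) | hτ
      · exact hf τ hτ
      · exact hstar hp _ (mem_starList.2 ⟨q', by simp [hq'], rfl⟩)
      · exact hstar hp τ (h4 τ hτ)
    · rw [shuffle_append_of_forall_mem _ _ (by rw [hstep]; exact h4), hstep]

/-- The pairs of an order with largest element `n` (given by the underlined factors) and a list
that is monotone relative to it. -/
def orderedPairs (n : ℕ) [NeZero n] : Set (List (Perm (Fin n)) × List (Perm (Fin n))) :=
  {s | ∃ e : Perm (Fin n), e ⊤ = ⊤ ∧ s.1 = starList e (n - 1) ∧ IsMonotoneFor e s.2}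

theorem bijOn_shuffle :
    Set.BijOn shuffle {f : List (Perm (Fin n)) | ∀ τ, τ ∈ f ↔ IsStar τ} (orderedPairs n) := by
  have hn : n - 1 < n := Nat.sub_one_lt (NeZero.ne n)
  have htop : ∀ {e : Perm (Fin n)}, e ⊤ = ⊤ → ∀ τ ∈ starList e (n - 1), IsTranspAt e ⊤ τ := by
    intro e he τ hτ
    obtain ⟨k, hk, rfl⟩ := mem_starList.1 hτ
    exact ⟨k, by rwa [Fin.lt_def, val_top], by rw [he]⟩
  refine ⟨?_, ?_, ?_⟩
  · intro f hf
    obtain ⟨h1, h2⟩ := underlinedOrder_spec (nodup_shuffle_fst f)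
      (fun τ => (mem_shuffle_fst f τ).trans (hf τ))
    refine ⟨_, h1, h2.symm, ?_⟩
    obtain ⟨r₀, t, h3, h4, h5, h6⟩ := isPartialShuffle_shuffle h1 hn h2.symm
    rw [h3, isMonotoneFor_append]
    refine ⟨h4, isMonotoneFor_of_forall fun τ hτ => htop h1 τ (h6 τ hτ), ?_⟩
    intro τ _ ρ hρ k l _ hl
    rw [hl.unique (htop h1 ρ (h6 ρ hρ))]
    exact le_top
  · exact shuffle_injOn.mono fun f hf τ hτ => (hf τ).1 hτ
  · rintro ⟨u, r⟩ ⟨e, he, hu, hr⟩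
    obtain ⟨r₀, t, hrt, h3, h4, h5, h6⟩ := hr.exists_split (n - 1)
    obtain ⟨f, hf, hf'⟩ := exists_shuffle_eq (r := r) he hn ⟨r₀, t, hrt, h3, by
      intro τ hτ
      obtain ⟨k, hk⟩ := h3.1 τ hτ
      exact ⟨k, h5 τ hτ k hk, hk⟩, by
      intro τ hτ
      obtain ⟨k, hk⟩ := h4.1 τ hτ
      have h7 := h6 τ hτ k hk
      have h8 : k = ⊤ := Fin.ext (by rw [val_top]; omega)
      obtain ⟨a, ha, rfl⟩ := h8 ▸ hk
      rw [he]
      exact mem_starList.2 ⟨a, by rwa [← val_top], rfl⟩⟩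
    have hu' : u = starList e (n - 1) := hu
    refine ⟨f, fun τ => ⟨hf τ, fun hτ => ?_⟩, by rw [hf', hu']⟩
    rw [← mem_shuffle_fst, hf']
    exact (mem_starList_top he).2 hτ

end star

/-! ### Orders and long cycles -/

/-- The product of the first `p` star transpositions is the cycle `(i₁ ⋯ i_p n)`. -/
theorem prodLR_starList_apply [NeZero n] {e : Perm (Fin n)} (he : e ⊤ = ⊤) {p : ℕ} (hp : p < n) :
    (∀ k l : Fin n, l.val = k.val + 1 → l.val < p → prodLR (starList e p) (e k) = e l) ∧
    (∀ k : Fin n, k.val + 1 = p → prodLR (starList e p) (e k) = ⊤) ∧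
    (∀ k : Fin n, p ≤ k.val → k ≠ ⊤ → prodLR (starList e p) (e k) = e k) ∧
    (∀ k : Fin n, k.val = 0 → 0 < p → prodLR (starList e p) ⊤ = e k) := by
  induction p with
  | zero => simp [starList, prodLR]
  | succ p ih =>
    obtain ⟨h1, h2, h3, h4⟩ := ih (by omega)
    have hpt : (⟨p, by omega⟩ : Fin n) ≠ ⊤ := fun h => by
      have := congrArg Fin.val h
      rw [val_top] at this
      simp only at this
      omega
    have hstep : ∀ x, prodLR (starList e (p + 1)) x =
        swap (e ⟨p, by omega⟩) ⊤ (prodLR (starList e p) x) := by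
      intro x
      rw [starList_succ e (by omega : p < n), prodLR_append]
      simp [prodLR]
    have hfix : ∀ l : Fin n, l.val ≠ p → l ≠ ⊤ → swap (e ⟨p, by omega⟩) ⊤ (e l) = e l := by
      intro l hl hlt
      refine swap_apply_of_ne_of_ne (fun h => hl (congrArg Fin.val (e.injective h))) ?_
      exact fun h => hlt (e.injective (h.trans he.symm))
    have hne : ∀ l : Fin n, l.val < n - 1 → l ≠ ⊤ := by
      rintro l hl rfl
      rw [val_top] at hl
      omega
    refine ⟨fun k l hkl hl => ?_, fun k hk => ?_, fun k hk hkt => ?_, fun k hk _ => ?_⟩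
    · rw [hstep]
      by_cases hlp : l.val < p
      · rw [h1 k l hkl hlp, hfix l hlp.ne (hne l (by omega))]
      · have : l = ⟨p, by omega⟩ := Fin.ext (by simp only; omega)
        rw [h2 k (by omega), swap_apply_right, this]
    · have : k = ⟨p, by omega⟩ := Fin.ext (by simp only; omega)
      rw [hstep, this, h3 _ le_rfl hpt, swap_apply_left]
    · rw [hstep, h3 k (by omega) hkt, hfix k (by omega) hkt]
    · rw [hstep]
      by_cases hp0 : 0 < p
      · rw [h4 k hk hp0, hfix k (by omega) (hne k (by omega))]
      · have h5 : p = 0 := by omega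
        subst h5
        have : k = ⟨0, by omega⟩ := Fin.ext hk
        simp [starList, prodLR, this]

theorem prodLR_starList [NeZero n] {e : Perm (Fin n)} (he : e ⊤ = ⊤) :
    prodLR (starList e (n - 1)) = e * finRotate n * e⁻¹ := by
  rw [eq_mul_inv_iff_mul_eq]
  ext1 k
  obtain ⟨m, rfl⟩ := Nat.exists_eq_succ_of_ne_zero (NeZero.ne n)
  obtain ⟨h1, h2, -, h4⟩ := prodLR_starList_apply he (p := m + 1 - 1) (by omega)
  have htop : (⊤ : Fin (m + 1)) = Fin.last m := rfl
  rw [Perm.mul_apply, Perm.mul_apply]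
  by_cases hk : k = Fin.last m
  · subst hk
    rw [finRotate_last, ← htop, he]
    rcases Nat.eq_zero_or_pos m with rfl | hm
    · exact Subsingleton.elim _ _
    · exact h4 0 rfl (by omega)
  · have hkv : (finRotate (m + 1) k).val = k.val + 1 := coe_finRotate_of_ne_last hk
    have hkm : k.val ≠ m := fun h => hk (Fin.ext h)
    have hlt := k.isLt
    by_cases hkl : k.val + 1 < m
    · exact h1 k _ hkv (by rw [hkv]; exact hkl)
    · rw [h2 k (by omega)]
      have : finRotate (m + 1) k = ⊤ := Fin.ext (by rw [hkv, htop, Fin.val_last]; omega)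
      rw [this, he]

theorem finRotate_castSucc {m : ℕ} (k : Fin m) : finRotate (m + 1) k.castSucc = k.succ :=
  Fin.ext (by rw [coe_finRotate_of_ne_last (Fin.castSucc_lt_last k).ne]; simp)

theorem partition_finRotate [NeZero n] : (finRotate n).partition.parts = {n} := by
  obtain ⟨m, rfl⟩ := Nat.exists_eq_succ_of_ne_zero (NeZero.ne n)
  rcases m with _ | m
  · have : finRotate 1 = 1 := Subsingleton.elim _ _
    rw [Nat.succ_eq_add_one, zero_add, this, Perm.parts_partition]
    simp
  · rw [Perm.parts_partition, support_finRotate, cycleType_finRotate]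
    simp

/-- A long cycle is written in exactly one way as `(i₁ ⋯ iₙ)` with `iₙ = n`. -/
theorem bijOn_order_cycle [NeZero n] :
    Set.BijOn (fun e : Perm (Fin n) => e * finRotate n * e⁻¹) {e | e ⊤ = ⊤}
      {σ | σ.partition.parts = {n}} := by
  refine ⟨?_, ?_, ?_⟩
  · intro e _
    have h : IsConj (finRotate n) (e * finRotate n * e⁻¹) := isConj_iff.2 ⟨e, rfl⟩
    rw [Set.mem_ofPred_eq, ← Perm.partition_eq_of_isConj.1 h]
    exact partition_finRotate
  · intro e he e' he' h
    obtain ⟨m, rfl⟩ := Nat.exists_eq_succ_of_ne_zero (NeZero.ne n)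
    have htop : (⊤ : Fin (m + 1)) = Fin.last m := rfl
    have hrot : ∀ f : Perm (Fin (m + 1)), ∀ k,
        f (finRotate (m + 1) k) = (f * finRotate (m + 1) * f⁻¹) (f k) := by
      intro f k
      simp
    have h' : e * finRotate (m + 1) * e⁻¹ = e' * finRotate (m + 1) * e'⁻¹ := h
    have hnext : ∀ k, e k = e' k → e (finRotate (m + 1) k) = e' (finRotate (m + 1) k) := by
      intro k hk
      rw [hrot e, hrot e', h', hk]
    ext1 k
    induction k using Fin.induction with
    | zero =>
      have := hnext (Fin.last m) (by rw [← htop]; exact Eq.trans he he'.symm)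
      rwa [finRotate_last] at this
    | succ k ih =>
      have := hnext _ ih
      rwa [finRotate_castSucc] at this
  · intro σ hσ
    have hc : IsConj (finRotate n) σ := by
      rw [Perm.partition_eq_of_isConj, Nat.Partition.ext_iff, partition_finRotate, hσ]
    obtain ⟨c, hc⟩ := isConj_iff.1 hc
    have hpow : ∀ y : Fin n, ∃ i : ℕ, (finRotate n ^ i) ⊤ = y := by
      obtain ⟨m, rfl⟩ := Nat.exists_eq_succ_of_ne_zero (NeZero.ne n)
      intro y
      induction y using Fin.induction with
      | zero => exact ⟨1, by rw [pow_one]; exact finRotate_last⟩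
      | succ k ih =>
        obtain ⟨i, hi⟩ := ih
        refine ⟨i + 1, ?_⟩
        rw [pow_succ', Perm.mul_apply, hi, finRotate_castSucc]
    obtain ⟨i, hi⟩ := hpow (c⁻¹ ⊤)
    refine ⟨c * finRotate n ^ i, ?_, ?_⟩
    · rw [Set.mem_ofPred_eq, Perm.mul_apply, hi]
      simp
    · rw [← hc]
      simp only [mul_inv_rev]
      have : finRotate n ^ i * finRotate n = finRotate n * finRotate n ^ i :=
        ((Commute.refl _).pow_left i).eq
      rw [mul_assoc c, this]
      group

/-! ### The maps `Γ` and `Θ` -/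

theorem isPretransitive_iff [NeZero n] {f : List (Perm (Fin n))} (hf : ∀ τ ∈ f, IsStar τ) :
    MulAction.IsPretransitive (Subgroup.closure {τ | τ ∈ f}) (Fin n) ↔ ∀ τ, IsStar τ → τ ∈ f := by
  constructor
  · rintro h τ ⟨a, ha, rfl⟩
    by_contra hmem
    -- a symbol `a` for which `(a n)` does not occur is fixed by all factors
    have hle : Subgroup.closure {τ | τ ∈ f} ≤ MulAction.stabilizer (Perm (Fin n)) a := by
      rw [Subgroup.closure_le]
      intro τ hτ
      obtain ⟨b, hb, rfl⟩ := hf τ hτ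
      have hab : a ≠ b := by
        rintro rfl
        exact hmem hτ
      exact swap_apply_of_ne_of_ne hab ha.ne
    obtain ⟨g, hg⟩ := h.exists_smul_eq a ⊤
    exact ha.ne ((hle g.2).symm.trans hg)
  · intro h
    have hmem : ∀ x : Fin n, swap x ⊤ ∈ Subgroup.closure {τ | τ ∈ f} := by
      intro x
      by_cases hx : x = ⊤
      · rw [hx, swap_self]
        exact Subgroup.one_mem _
      · exact Subgroup.subset_closure (h _ ⟨x, lt_top_iff_ne_top.2 hx, rfl⟩)
    refine ⟨fun x y => ⟨⟨_, Subgroup.mul_mem _ (hmem y) (hmem x)⟩, ?_⟩⟩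
    change (swap y ⊤ * swap x ⊤) x = y
    simp

theorem bijOn_Gamma_orderedPairs [NeZero n] (W : SimpleWords n) :
    Set.BijOn (fun s => (prodLR s.1, reorder W (underlinedOrder s.1) s.2)) (orderedPairs n)
      {s | s.1.partition.parts = {n} ∧ IsMonotone s.2} := by
  have hu : ∀ {e : Perm (Fin n)}, e ⊤ = ⊤ → underlinedOrder (starList e (n - 1)) = e := by
    intro e he
    obtain ⟨h1, h2⟩ := underlinedOrder_spec (nodup_starList e (n - 1)) fun τ => mem_starList_top he
    exact starList_injOn h1 he h2
  refine ⟨?_, ?_, ?_⟩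
  · rintro ⟨u, r⟩ ⟨e, he, rfl, hr⟩
    refine ⟨?_, ?_⟩
    · simp only [prodLR_starList he]
      exact bijOn_order_cycle.mapsTo he
    · simp only [hu he]
      exact (reorder_spec e W).1.mapsTo hr
  · rintro ⟨u, r⟩ ⟨e, he, hue, hr⟩ ⟨u', r'⟩ ⟨e', he', hue', hr'⟩ h
    simp only at hue hue' hr hr'
    subst hue hue'
    simp only [hu he, hu he', prodLR_starList he, prodLR_starList he', Prod.mk.injEq] at h
    obtain rfl := bijOn_order_cycle.injOn he he' h.1
    rw [(reorder_spec e W).1.injOn hr hr' h.2]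
  · rintro ⟨σ, L⟩ ⟨hσ, hL⟩
    obtain ⟨e, he, rfl⟩ := bijOn_order_cycle.surjOn hσ
    obtain ⟨r, hr, rfl⟩ := (reorder_spec e W).1.surjOn hL
    exact ⟨(starList e (n - 1), r), ⟨e, he, rfl, hr⟩, by simp only [hu he, prodLR_starList he]⟩

/-- A bijection restricts to the subsets cut out by a condition that it preserves. -/
theorem bijOn_restrict {α β : Type*} {f : α → β} {s s' : Set α} {t t' : Set β}
    (h : Set.BijOn f s t) (hs : s' ⊆ s) (ht : t' ⊆ t) (hiff : ∀ a ∈ s, f a ∈ t' ↔ a ∈ s') :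
    Set.BijOn f s' t' := by
  refine ⟨fun a ha => (hiff a (hs ha)).2 ha, h.injOn.mono hs, fun b hb => ?_⟩
  obtain ⟨a, ha, rfl⟩ := h.surjOn (ht hb)
  exact ⟨a, (hiff a ha).1 hb, rfl⟩

theorem bijOn_Gamma [NeZero n] (W : SimpleWords n) (g : ℕ) (ω : Perm (Fin n)) :
    Set.BijOn (Gamma W) (starFactorisations g ω) (monotoneDoubleHurwitz g ω) := by
  have h : Set.BijOn (Gamma W) _ _ := (bijOn_Gamma_orderedPairs W).comp bijOn_shuffle
  refine bijOn_restrict h ?_ (fun s hs => ⟨hs.2.1, hs.2.2.2⟩) ?_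
  · rintro f ⟨h1, -, -, h2⟩ τ
    exact ⟨h1 τ, (isPretransitive_iff h1).1 h2 τ⟩
  · intro f hf
    have hf' : ∀ τ ∈ f, IsStar τ := fun τ => (hf τ).1
    obtain ⟨h1, h2⟩ := h.mapsTo hf
    obtain ⟨he, hu⟩ := underlinedOrder_spec (nodup_shuffle_fst f)
      (fun τ => (mem_shuffle_fst f τ).trans (hf τ))
    have hr : IsMonotoneFor (underlinedOrder (shuffle f).1) (shuffle f).2 := by
      obtain ⟨e, he', hu', hr⟩ := bijOn_shuffle.mapsTo hf
      rwa [starList_injOn he he' (hu.trans hu')]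
    obtain ⟨h3, h4⟩ := (reorder_spec _ W).2 _ hr
    have hlen := length_shuffle f
    have hlu : (shuffle f).1.length = n - 1 := by rw [← hu, length_starList _ (by omega)]
    have hn := NeZero.ne n
    have hprod : prodLR ((Gamma W f).1 :: (Gamma W f).2) = prodLR f := by
      rw [← prodLR_shuffle fun τ hτ => (hf' τ hτ).mul_self, ← h3]
      rfl
    have hlen' : (Gamma W f).2.length = (shuffle f).2.length := h4
    constructor
    · rintro ⟨h5, -, h6, -⟩
      exact ⟨hf', hprod ▸ h5, by omega, (isPretransitive_iff hf').2 fun τ => (hf τ).2⟩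
    · rintro ⟨-, h5, h6, -⟩
      exact ⟨hprod.trans h5, h1, by omega, h2⟩

theorem isTranspAt_conj_iff (δ : Perm (Fin n)) (k : Fin n) (τ : Perm (Fin n)) :
    IsTranspAt δ⁻¹ k (conj τ δ) ↔ IsTranspAt 1 k τ := by
  unfold IsTranspAt
  refine exists_congr fun a => and_congr_right fun _ => ?_
  rw [← conj_swap, (conj_injective δ).eq_iff]
  rfl

theorem isMonotoneFor_map_conj_iff (δ : Perm (Fin n)) (L : List (Perm (Fin n))) :
    IsMonotoneFor δ⁻¹ (L.map fun τ => conj τ δ) ↔ IsMonotoneFor 1 L := by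
  unfold IsMonotoneFor
  rw [List.pairwise_map]
  simp only [List.mem_map, forall_exists_index, and_imp, forall_apply_eq_imp_iff₂,
    isTranspAt_conj_iff]

theorem partition_conj (σ δ : Perm (Fin n)) : (conj σ δ).partition = σ.partition := by
  refine (Perm.partition_eq_of_isConj.1 (isConj_iff.2 ⟨δ⁻¹, ?_⟩)).symm
  rw [conj_eq, inv_inv]

theorem bijOn_Theta (W : SimpleWords n) (g : ℕ) (ω δ : Perm (Fin n)) :
    Set.BijOn (Theta W δ) (monotoneDoubleHurwitz g ω) (monotoneDoubleHurwitz g (conj ω δ)) := by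
  have hinv : ∀ σ, conj (conj σ δ⁻¹) δ = σ := fun σ => by simp [conj_eq, mul_assoc]
  have h : Set.BijOn (Theta W δ) {s | IsMonotone s.2} {s | IsMonotone s.2} := by
    have hW := (reorder_spec δ⁻¹ W).1
    refine ⟨?_, ?_, ?_⟩
    · rintro ⟨σ, L⟩ hL
      exact hW.mapsTo ((isMonotoneFor_map_conj_iff δ L).2 ((isMonotone_iff L).1 hL))
    · rintro ⟨σ, L⟩ hL ⟨σ', L'⟩ hL' h
      simp only [Theta, Prod.mk.injEq] at h
      have h2 := hW.injOn ((isMonotoneFor_map_conj_iff δ L).2 ((isMonotone_iff L).1 hL))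
        ((isMonotoneFor_map_conj_iff δ L').2 ((isMonotone_iff L').1 hL')) h.2
      rw [conj_injective δ h.1, List.map_injective_iff.2 (conj_injective δ) h2]
    · rintro ⟨σ, L⟩ hL
      obtain ⟨M, hM, rfl⟩ := hW.surjOn hL
      have hmap : (M.map fun τ => conj τ δ⁻¹).map (fun τ => conj τ δ) = M := by
        simp [Function.comp_def, hinv]
      refine ⟨(conj σ δ⁻¹, M.map fun τ => conj τ δ⁻¹), ?_, ?_⟩
      · refine (isMonotone_iff _).2 ((isMonotoneFor_map_conj_iff δ _).1 ?_)
        rw [hmap]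
        exact hM
      · simp only [Theta, hmap, hinv]
  refine bijOn_restrict h (fun s hs => hs.2.2.2) (fun s hs => hs.2.2.2) ?_
  intro s hs
  have hmono := (isMonotoneFor_map_conj_iff δ s.2).2 ((isMonotone_iff _).1 hs)
  obtain ⟨h1, h2⟩ := (reorder_spec δ⁻¹ W).2 _ hmono
  have hprod : prodLR ((Theta W δ s).1 :: (Theta W δ s).2) = conj (prodLR (s.1 :: s.2)) δ := by
    rw [← prodLR_map_conj, List.map_cons, prodLR, prodLR, ← h1]
    rfl
  have hlen : (Theta W δ s).2.length = s.2.length := by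
    rw [← List.length_map (fun τ => conj τ δ) (as := s.2), ← h2]
    rfl
  have hpart : (Theta W δ s).1.partition = s.1.partition := partition_conj _ _
  have hmaps : IsMonotone (Theta W δ s).2 := h.mapsTo hs
  have hcyc : numCycles (conj ω δ) = numCycles ω := by rw [numCycles, partition_conj, numCycles]
  unfold monotoneDoubleHurwitz
  simp only [Set.mem_ofPred_eq, hprod, hlen, hpart, hcyc, hmaps, (conj_injective δ).eq_iff]
  have hs' : IsMonotone s.2 := hs
  simp only [hs']

end StarFactorisation

theorem theorem4p1 (n : ℕ) [NeZero n] (ω : Equiv.Perm (Fin n)) (g : ℕ) :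
    -- whatever words are used to define the reordering bijections, `Γ` is a bijection
    (∀ W : StarFactorisation.SimpleWords n,
      Set.BijOn (StarFactorisation.Gamma W)
        (StarFactorisation.starFactorisations g ω)
        (StarFactorisation.monotoneDoubleHurwitz g ω)) ∧
    -- `Θ` is a bijection, and `Γ`, `Θ` and `Γ⁻¹` compose to a bijection `A_g(ω) → A_g(γ)`
    (∀ (W : StarFactorisation.SimpleWords n) (γ δ : Equiv.Perm (Fin n)),
      γ = StarFactorisation.conj ω δ →
      Set.BijOn (StarFactorisation.Theta W δ)
        (StarFactorisation.monotoneDoubleHurwitz g ω)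
        (StarFactorisation.monotoneDoubleHurwitz g γ) ∧
      Set.BijOn
        (Function.invFunOn (StarFactorisation.Gamma W)
            (StarFactorisation.starFactorisations g γ) ∘
          StarFactorisation.Theta W δ ∘ StarFactorisation.Gamma W)
        (StarFactorisation.starFactorisations g ω)
        (StarFactorisation.starFactorisations g γ)) ∧
    -- star factorisations are central
    (∀ γ : Equiv.Perm (Fin n), IsConj ω γ →
      (StarFactorisation.starFactorisations g ω).ncard =
        (StarFactorisation.starFactorisations g γ).ncard) := by
  have composite : ∀ (W : StarFactorisation.SimpleWords n) (δ : Equiv.Perm (Fin n)),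
      Set.BijOn
        (Function.invFunOn (StarFactorisation.Gamma W)
            (StarFactorisation.starFactorisations g (StarFactorisation.conj ω δ)) ∘
          StarFactorisation.Theta W δ ∘ StarFactorisation.Gamma W)
        (StarFactorisation.starFactorisations g ω)
        (StarFactorisation.starFactorisations g (StarFactorisation.conj ω δ)) := by
    intro W δ
    have h := StarFactorisation.bijOn_Gamma W g (StarFactorisation.conj ω δ)
    exact (h.symm h.invOn_invFunOn.symm).comp
      ((StarFactorisation.bijOn_Theta W g ω δ).comp (StarFactorisation.bijOn_Gamma W g ω))
  refine ⟨fun W => StarFactorisation.bijOn_Gamma W g ω, ?_, ?_⟩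
  · rintro W γ δ rfl
    exact ⟨StarFactorisation.bijOn_Theta W g ω δ, composite W δ⟩
  · intro γ hγ
    obtain ⟨c, rfl⟩ := isConj_iff.1 hγ
    have W : StarFactorisation.SimpleWords n :=
      Classical.choice (StarFactorisation.nonempty_simpleWords n)
    have h := composite W c⁻¹
    rw [StarFactorisation.conj_eq, inv_inv] at h
    rw [← h.image_eq, h.injOn.ncard_image]
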